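/- Let $K$ be a field and let $A$ be a finite-dimensional selfinjective $K$-algebra, that is, $A$ is injective as a right module over itself. All modules are finitely generated right modules. For an $A$-module $X$, let $\operatorname{add}(X)$ denote the class of all direct summands of finite direct sums of copies of $X$. For $n\ge 1$, an $A$-module $X$ is called maximal $n$-orthogonal if for every $A$-module $M$ the following three conditions are equivalent: (i) $\operatorname{Ext}^i_A(M,X)=0$ for all $1\le i\le n$; (ii) $\operatorname{Ext}^i_A(X,M)=0$ for all $1\le i\le n$; (iii) $M\in\operatorname{add}(X)$. The complexity of an $A$-module $M$ with minimal projective resolution $\cdots\to P_2\to P_1\to P_0\to M\to 0$ is $$\operatorname{cx}(M)=\inf\{b\in\mathbb{N}_0 \mid \exists\, c>0:\ \dim_K P_i\le c\, i^{b-1}\text{ for all } i\ge 1\}\in\mathbb{N}_0\cup\{\infty\}.$$ Theorem 1.1. Suppose that for some $n\ge 1$ there exists a maximal $n$-orthogonal $A$-module. Then every $A$-module $M$ satisfies $\operatorname{cx}(M)\le 1$; equivalently, the dimensions $\dim_K P_i$ of the terms of the minimal projective resolution of $M$ are bounded. -/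

import Mathlib

open CategoryTheory

universe u v

/-- `A` is (right) selfinjective: it is injective as a right module over itself.
Throughout, right `A`-modules are modules over the opposite ring `Aᵐᵒᵖ`. -/
def IsSelfinjective (A : Type v) [Ring A] : Prop :=
  Module.Injective Aᵐᵒᵖ A

section

variable {R : Type v} [Ring R]

/-- `M ∈ add X`: `M` is a direct summand of a finite direct sum of copies of `X`. -/
def MemAdd (X M : ModuleCat.{v} R) : Prop :=
  ∃ (k : ℕ) (s : M →ₗ[R] (Fin k → X)) (r : (Fin k → X) →ₗ[R] M), r ∘ₗ s = LinearMap.id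

/-- The finitely generated module `X` is maximal `n`-orthogonal: for every finitely generated `M`,
vanishing of `Ext^i(M, X)` for `1 ≤ i ≤ n`, vanishing of `Ext^i(X, M)` for `1 ≤ i ≤ n`, and
membership of `M` in `add X` are equivalent. -/
def IsMaximalOrthogonal (n : ℕ) (X : ModuleCat.{v} R) : Prop :=
  Module.Finite R X ∧
    ∀ M : ModuleCat.{v} R, Module.Finite R M →
      [ ∀ i : ℕ, 1 ≤ i → i ≤ n → Subsingleton (Abelian.Ext M X i),
        ∀ i : ℕ, 1 ≤ i → i ≤ n → Subsingleton (Abelian.Ext X M i),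
        MemAdd X M ].TFAE

/-- A submodule `S` of `P` is superfluous if `S + T = P` forces `T = P`. -/
def IsSuperfluous {P : Type*} [AddCommGroup P] [Module R P] (S : Submodule R P) : Prop :=
  ∀ T : Submodule R P, S ⊔ T = ⊤ → T = ⊤

/-- A projective resolution `⋯ → P₁ → P₀ → M → 0` is minimal if every `Pᵢ` is a projective cover of
the next syzygy, that is, if the kernel of the map out of `Pᵢ` (to `P_{i-1}`, or to `M` when
`i = 0`), which by exactness is the image of `P_{i+1} → P_i`, is superfluous in `Pᵢ`. -/
def IsMinimalResolution {M : ModuleCat.{v} R} (P : ProjectiveResolution M) : Prop :=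
  ∀ i : ℕ, IsSuperfluous (LinearMap.range (P.complex.d (i + 1) i).hom)

variable (K : Type u) [Field K] [Algebra K R]

/-- The dimension over `K` of the `i`-th term of a resolution of a module over a `K`-algebra. (For
a minimal resolution of a finitely generated module over a finite-dimensional algebra, all terms
are finite-dimensional.) -/
noncomputable def termDim {M : ModuleCat.{v} R} (P : ProjectiveResolution M) (i : ℕ) : ℕ :=
  Module.finrank K (RestrictScalars K R (P.complex.X i))

/-- The complexity of `M`: the infimum in `ℕ ∪ {∞}` of all `b` such that the terms of a minimal
projective resolution (which is unique up to isomorphism) satisfy `dim Pᵢ ≤ c * i ^ (b - 1)`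
for all `i ≥ 1`, for some constant `c > 0`. The infimum of the empty set is `∞`. -/
noncomputable def complexity (M : ModuleCat.{v} R) : ℕ∞ :=
  sInf ((fun b : ℕ => (b : ℕ∞)) ''
    {b : ℕ | ∃ P : ProjectiveResolution M, IsMinimalResolution P ∧
      ∃ c : ℝ, 0 < c ∧ ∀ i : ℕ, 1 ≤ i → (termDim K P i : ℝ) ≤ c * (i : ℝ) ^ ((b : ℤ) - 1)})

end

/-!
Right `A`-modules are left modules over `R = Aᵐᵒᵖ`, a finite-dimensional algebra that is injective as
a left module over itself. Let `X` be maximal `n`-orthogonal. The bound on minimal resolutions comes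
from a self-map of `add X` that does not change the size of stable endomorphism algebras.

Let `D` be the `K`-dual and `ν M = D Hom_R(M, R)` the Nakayama functor. As `R` is injective over
itself and embeds every simple module, `ν` is exact, fully faithful on finitely generated modules,
and preserves projectives and simple modules (`Nakayama.map_exact`, `Nakayama.map_full`,
`Nakayama.map_faithful`, `Nakayama.projective`, `Nakayama.isSimpleModule`). Hence it preserves
dimensions of `Ext` groups (`finrank_ext_nakayamaObj`). The vanishing half of the Auslander–Reiten
formula (`subsingleton_ext_nakayamaObj`) shows that `ν Ω^{n+2} Y` is again in `add X` when `Y` is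
(`IsMaximalOrthogonal.memAdd_nakayamaObj`).

For simple `S` one gets `Ext^{i+n+2}(Y, S) ≅ Ext^i(ν Ω^{n+2} Y, ν S)`, so all `Ext^i(Y, S)` reduce to
extensions of bounded degree between members of `add X` and simple modules. The members that occur
stay bounded up to projective summands: each nonprojective indecomposable summand of a module in
`add X` is a summand of `X`, and their number is at most the dimension of the stable endomorphism
algebra (`MemAdd.finrank_ext_le_stableDim_mul`), which neither `ν` nor `Ω` changes. This gives a bound
for `dim Ext^i(X, S)`, uniform in `i` and `S`. Every finitely generated `M` has an `add X`-resolution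
of length at most `n`, so the same holds for `M` (`IsMaximalOrthogonal.exists_bound`).

In a minimal resolution `P` of `M` the space `Hom(Pᵢ, S)` has the dimension of `Ext^i(M, S)`. The
length of `R` then bounds `dim Hom(Pᵢ, R)`, and `Pᵢ` embeds into a power of `R` with
`dim Hom(Pᵢ, R)` factors, which bounds `dim Pᵢ` (`IsMaximalOrthogonal.exists_generators_bound`).
Since `Ext` of modules is linear here over a field in the universe of `R`, the argument is run over
such a copy of `K`.
-/

/-! ### Simple modules and their annihilators -/

section SimpleModules

variable {R : Type v} [Ring R]

/-- If the kernel of a map to a finite product of simple modules is contained in the kernel of a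
nonzero map to a simple module `T`, then `T` is isomorphic to one of the factors. -/
theorem exists_linearEquiv_of_ker_le {ι : Type*} [Finite ι] {S : ι → Type*}
    [∀ i, AddCommGroup (S i)] [∀ i, Module R (S i)] [∀ i, IsSimpleModule R (S i)]
    {V T : Type*} [AddCommGroup V] [Module R V] [AddCommGroup T] [Module R T] [IsSimpleModule R T]
    (f : V →ₗ[R] (∀ i, S i)) (q : V →ₗ[R] T) (hq : q ≠ 0)
    (h : LinearMap.ker f ≤ LinearMap.ker q) : ∃ i, Nonempty (S i ≃ₗ[R] T) := by
  classical
  obtain ⟨g, hg⟩ := IsSemisimpleModule.extension_property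
    ((LinearMap.ker f).liftQ f le_rfl)
    (LinearMap.ker_eq_bot.1 (Submodule.ker_liftQ_eq_bot' _ _ rfl))
    ((LinearMap.ker f).liftQ q h)
  by_contra hcon
  apply hq
  have hz : ∀ i, g ∘ₗ LinearMap.single R S i = 0 := fun i =>
    (LinearMap.bijective_or_eq_zero (g ∘ₗ LinearMap.single R S i)).resolve_left
      fun hb => hcon ⟨i, ⟨LinearEquiv.ofBijective _ hb⟩⟩
  have hg0 : g = 0 := LinearMap.pi_ext' fun i => by rw [hz i]; rfl
  ext x
  have := LinearMap.congr_fun hg ((LinearMap.ker f).mkQ x)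
  simpa [hg0] using this.symm

/-- Over an algebra, finite-dimensional simple modules are determined by their annihilators: a
basis of `S` embeds `R ⧸ Ann S` into a power of `S`. -/
theorem linearEquiv_of_annihilator_le {K : Type*} [Field K] [Algebra K R] {S T : Type*}
    [AddCommGroup S] [Module R S] [Module K S] [IsScalarTower K R S] [Module.Finite K S]
    [AddCommGroup T] [Module R T] [IsSimpleModule R S] [IsSimpleModule R T]
    (h : ∀ r : R, (∀ s : S, r • s = 0) → ∀ t : T, r • t = 0) : Nonempty (S ≃ₗ[R] T) := by
  have := IsSimpleModule.nontrivial R T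
  obtain ⟨t, ht⟩ := exists_ne (0 : T)
  let b := Module.finBasis K S
  obtain ⟨_, e⟩ := exists_linearEquiv_of_ker_le (ι := Fin (Module.finrank K S))
    (LinearMap.pi fun i => LinearMap.toSpanSingleton R S (b i)) (LinearMap.toSpanSingleton R T t)
    (fun h0 => ht (by simpa using LinearMap.congr_fun h0 1)) (by
      intro r hr
      refine h r (fun s => ?_) t
      have hr' : ∀ i, r • b i = 0 := fun i => congr_fun (LinearMap.mem_ker.1 hr) i
      rw [← b.sum_repr s, Finset.smul_sum]
      refine Finset.sum_eq_zero fun i _ => ?_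
      rw [← algebraMap_smul R (b.repr s i), ← mul_smul, ← Algebra.commutes, mul_smul, hr' i,
        smul_zero])
  exact e

/-- The annihilators of the simple modules `R ⧸ L`, with `L` a maximal left ideal. -/
def simpleAnnihilators (R : Type*) [Ring R] : Set (Ideal R) :=
  (fun L : Ideal R => Module.annihilator R (R ⧸ L)) '' {L | L.IsMaximal}

theorem annihilator_mem_simpleAnnihilators {R : Type*} [Ring R] (S : Type*) [AddCommGroup S]
    [Module R S] [IsSimpleModule R S] : Module.annihilator R S ∈ simpleAnnihilators R := by
  obtain ⟨L, hL, ⟨e⟩⟩ := isSimpleModule_iff_quot_maximal.1 ‹IsSimpleModule R S›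
  exact ⟨L, hL, e.annihilator_eq.symm⟩

theorem finite_simpleAnnihilators [IsArtinianRing R] : (simpleAnnihilators R).Finite := by
  classical
  -- A minimal finite intersection of maximal left ideals lies in every maximal left ideal.
  let 𝒮 : Set (Ideal R) := {I | ∃ F : Finset (Ideal R), (∀ L ∈ F, L.IsMaximal) ∧ I = F.inf id}
  obtain ⟨I, ⟨F, hF, rfl⟩, hmin⟩ := IsArtinian.set_has_minimal 𝒮 ⟨⊤, ∅, by simp, by simp⟩
  refine (F.finite_toSet.image fun L => Module.annihilator R (R ⧸ L)).subset ?_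
  rintro _ ⟨L, hL : L.IsMaximal, rfl⟩
  have hle : F.inf id ≤ L := by
    have h1 := hmin ((insert L F).inf id) ⟨insert L F, by simpa using ⟨hL, hF⟩, rfl⟩
    rw [Finset.inf_insert, id] at h1
    by_contra h2
    exact h1 (lt_of_le_of_ne inf_le_right fun h3 => h2 (h3 ▸ inf_le_left))
  have hs : ∀ i : F, IsSimpleModule R (R ⧸ (i : Ideal R)) := fun i =>
    isSimpleModule_iff_quot_maximal.2 ⟨i, hF _ i.2, ⟨.refl _ _⟩⟩
  have hsL : IsSimpleModule R (R ⧸ L) := isSimpleModule_iff_quot_maximal.2 ⟨L, hL, ⟨.refl _ _⟩⟩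
  obtain ⟨i, ⟨e⟩⟩ := exists_linearEquiv_of_ker_le (S := fun i : F => R ⧸ (i : Ideal R))
    (LinearMap.pi fun i : F => (i : Ideal R).mkQ) L.mkQ
    (fun h0 => hL.ne_top (by rw [← L.ker_mkQ, h0, LinearMap.ker_zero])) (by
      intro x hx
      rw [L.ker_mkQ]
      refine hle ((Submodule.mem_finsetInf).2 fun J hJ => ?_)
      have := congr_fun (LinearMap.mem_ker.1 hx) ⟨J, hJ⟩
      simpa [Submodule.Quotient.mk_eq_zero] using this)
  exact ⟨i, i.2, e.annihilator_eq⟩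

end SimpleModules

/-! ### Selfinjective algebras cogenerate their modules -/

section Kasch

variable {R : Type*} [Ring R]

/-- Over a left selfinjective ring, a linear map from a left ideal to `R` is a right
multiplication. -/
theorem Module.Baer.exists_mul_right (hR : Module.Baer R R) {N : Submodule R R}
    (f : N →ₗ[R] R) : ∃ c : R, ∀ x : N, f x = x * c := by
  obtain ⟨g, hg⟩ := hR.extension_property N.subtype N.injective_subtype f
  exact ⟨g 1, fun x => by rw [← hg]; simpa using (g.map_smul (x : R) 1)⟩

/-- If `R` is left selfinjective, every proper two-sided ideal `I` has nonzero left annihilator: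
otherwise right multiplication by a basis of `I` would embed `R` into a power of `R`, and a
retraction of this embedding would show `1 ∈ I`. -/
theorem Module.Baer.exists_mul_eq_zero (K : Type*) [Field K] [Algebra K R] [Module.Finite K R]
    (hR : Module.Baer R R) (I : Ideal R) [I.IsTwoSided]
    (hI : I ≠ ⊤) : ∃ x : R, x ≠ 0 ∧ ∀ a ∈ I, x * a = 0 := by
  let V : Submodule K R := I.restrictScalars K
  let b := Module.finBasis K V
  by_contra! hcon
  have hinj : Function.Injective
      (LinearMap.pi fun i => LinearMap.toSpanSingleton R R (b i : R) : R →ₗ[R] (_ → R)) := by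
    rw [injective_iff_map_eq_zero]
    intro x hx
    by_contra hx0
    obtain ⟨a, ha, hxa⟩ := hcon x hx0
    apply hxa
    have h1 : ∀ i, x * (b i : R) = 0 := fun i => congr_fun hx i
    have h2 : a = ((∑ i, b.repr ⟨a, ha⟩ i • b i : V) : R) := by rw [b.sum_repr]
    rw [h2, Submodule.coe_sum, Finset.mul_sum]
    exact Finset.sum_eq_zero fun i _ => by simp [h1]
  obtain ⟨g, hg⟩ := hR.extension_property _ hinj LinearMap.id
  apply hI
  rw [Ideal.eq_top_iff_one]
  have h1 := LinearMap.congr_fun hg 1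
  simp only [LinearMap.comp_apply, LinearMap.id_apply] at h1
  rw [← h1, LinearMap.pi_apply_eq_sum_univ g]
  refine Ideal.sum_mem _ fun i _ => ?_
  simpa using I.mul_mem_right _ (b i).2

/-- Every simple left module `S` over a left selfinjective finite-dimensional algebra embeds into
the algebra. Each annihilator `𝔪` of a simple module has a simple left ideal `T 𝔪` in its left
annihilator. The map sending `𝔪` to the annihilator of `T 𝔪` is injective, because every
isomorphism `T 𝔪₁ ≃ T 𝔪₂` is a right multiplication. As there are finitely many `𝔪`, every simple
module has the annihilator of some `T 𝔪`, and hence is isomorphic to it. -/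
theorem Module.Baer.exists_injective_of_isSimpleModule (K : Type*) [Field K] [Algebra K R]
    [Module.Finite K R] (hR : Module.Baer R R)
    (S : Type*) [AddCommGroup S] [Module R S] [IsSimpleModule R S] :
    ∃ f : S →ₗ[R] R, Function.Injective f := by
  have : IsArtinianRing R := IsArtinianRing.of_finite K R
  -- `T 𝔪` is a simple left ideal with `T 𝔪 * 𝔪 = 0`.
  have key : ∀ 𝔪 : simpleAnnihilators R, ∃ T : Submodule R R, IsSimpleModule R T ∧
      ∀ x ∈ T, ∀ a ∈ 𝔪.1, x * a = 0 := by
    rintro ⟨_, L, hL : L.IsMaximal, rfl⟩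
    have hne : Module.annihilator R (R ⧸ L) ≠ ⊤ := by
      rw [Ne, Module.annihilator_eq_top_iff]
      exact fun h => hL.ne_top (Submodule.Quotient.subsingleton_iff.1 h)
    obtain ⟨x, hx0, hx⟩ := hR.exists_mul_eq_zero K _ hne
    obtain h0 | ⟨T, hT, hTx⟩ := IsAtomic.eq_bot_or_exists_atom_le (Submodule.span R {x})
    · exact absurd (by simpa using h0) hx0
    · refine ⟨T, isSimpleModule_iff_isAtom.2 hT, fun y hy a ha => ?_⟩
      obtain ⟨r, rfl⟩ := Submodule.mem_span_singleton.1 (hTx hy)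
      rw [smul_eq_mul, mul_assoc, hx a ha, mul_zero]
  choose T hTs hT using key
  let φ : simpleAnnihilators R → simpleAnnihilators R := fun 𝔪 =>
    ⟨_, annihilator_mem_simpleAnnihilators (T 𝔪)⟩
  -- simple modules over a finite-dimensional algebra with comparable annihilators are isomorphic
  have hiso : ∀ (U : Type _) [AddCommGroup U] [Module R U] [IsSimpleModule R U] (L : Ideal R),
      L.IsMaximal → Module.annihilator R (R ⧸ L) ≤ Module.annihilator R U →
      Nonempty ((R ⧸ L) ≃ₗ[R] U) := by
    intro U _ _ _ L hL hle
    have : IsSimpleModule R (R ⧸ L) := isSimpleModule_iff_quot_maximal.2 ⟨L, hL, ⟨.refl _ _⟩⟩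
    exact linearEquiv_of_annihilator_le (K := K) fun r hr t =>
      Module.mem_annihilator.1 (hle (Module.mem_annihilator.2 hr)) t
  have hφ : Function.Injective φ := by
    intro 𝔪₁ 𝔪₂ h12
    have hann : Module.annihilator R (T 𝔪₁) = Module.annihilator R (T 𝔪₂) :=
      congrArg Subtype.val h12
    obtain ⟨L, hL, hLann⟩ := annihilator_mem_simpleAnnihilators (R := R) (T 𝔪₁)
    obtain ⟨e₁⟩ := hiso (T 𝔪₁) L hL hLann.le
    obtain ⟨e₂⟩ := hiso (T 𝔪₂) L hL (hLann.le.trans hann.le)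
    obtain ⟨c, hc⟩ := hR.exists_mul_right ((T 𝔪₂).subtype ∘ₗ (e₁.symm.trans e₂).toLinearMap)
    -- the nonzero left ideal `T 𝔪₂ = T 𝔪₁ * c` is annihilated from the right by `𝔪₁ + 𝔪₂`
    have hsup : 𝔪₁.1 ⊔ 𝔪₂.1 ≠ ⊤ := by
      intro htop
      have := IsSimpleModule.nontrivial R (T 𝔪₂)
      obtain ⟨y, hy0⟩ := exists_ne (0 : T 𝔪₂)
      obtain ⟨x, rfl⟩ := (e₁.symm.trans e₂).surjective y
      have hx := hc x
      simp only [LinearMap.comp_apply, Submodule.subtype_apply, LinearEquiv.coe_coe] at hx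
      obtain ⟨a, ha, b, hb, hab⟩ := Submodule.mem_sup.1 (htop ▸ Submodule.mem_top : (1 : R) ∈ _)
      apply hy0
      apply Subtype.ext
      have e1 : (((e₁.symm.trans e₂) x : T 𝔪₂) : R) * a = 0 := by
        rw [hx, mul_assoc]; exact hT 𝔪₁ _ x.2 _ (𝔪₁.1.mul_mem_left c ha)
      have e2 := hT 𝔪₂ _ ((e₁.symm.trans e₂) x).2 _ hb
      rw [← mul_one (((e₁.symm.trans e₂) x : T 𝔪₂) : R), ← hab, mul_add, e1, e2, add_zero]; rfl
    obtain ⟨L', hL', hle⟩ := Ideal.exists_le_maximal _ hsup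
    have hsim : IsSimpleModule R (R ⧸ L') :=
      isSimpleModule_iff_quot_maximal.2 ⟨L', hL', ⟨.refl _ _⟩⟩
    have hEq : ∀ 𝔪 : simpleAnnihilators R, 𝔪.1 ≤ L' →
        𝔪.1 = Module.annihilator R (R ⧸ L') := by
      rintro ⟨_, L₀, hL₀, rfl⟩ h
      obtain ⟨e⟩ := hiso (R ⧸ L') L₀ hL₀ (by
        intro r hr
        rw [Module.mem_annihilator]
        rintro ⟨s⟩
        have : r * s ∈ Module.annihilator R (R ⧸ L₀) := Ideal.mul_mem_right _ _ hr
        exact (Submodule.Quotient.mk_eq_zero _).2 (h this))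
      exact e.annihilator_eq
    exact Subtype.ext ((hEq 𝔪₁ (le_sup_left.trans hle)).trans
      (hEq 𝔪₂ (le_sup_right.trans hle)).symm)
  have : Finite (simpleAnnihilators R) := finite_simpleAnnihilators.to_subtype
  obtain ⟨𝔪, h𝔪⟩ := Finite.surjective_of_injective hφ
    ⟨_, annihilator_mem_simpleAnnihilators S⟩
  have hann : Module.annihilator R (T 𝔪) = Module.annihilator R S := congrArg Subtype.val h𝔪
  obtain ⟨e⟩ := linearEquiv_of_annihilator_le (K := K) (S := T 𝔪) (T := S) fun r hr t =>
      Module.mem_annihilator.1 (hann.le (Module.mem_annihilator.2 hr)) t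
  exact ⟨(T 𝔪).subtype ∘ₗ e.symm.toLinearMap, by
    simpa using e.symm.injective⟩

/-- Finitely generated modules over a left selfinjective finite-dimensional algebra are
torsionless. -/
theorem Module.Baer.exists_apply_ne_zero (K : Type*) [Field K] [Algebra K R] [Module.Finite K R]
    (hR : Module.Baer R R) {M : Type*} [AddCommGroup M] [Module R M]
    {x : M} (hx : x ≠ 0) : ∃ f : M →ₗ[R] R, f x ≠ 0 := by
  have hL : LinearMap.ker (LinearMap.toSpanSingleton R M x) ≠ ⊤ := fun h => hx (by
    have : (1 : R) ∈ LinearMap.ker (LinearMap.toSpanSingleton R M x) := h ▸ Submodule.mem_top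
    simpa using this)
  obtain ⟨L, hLm, hle⟩ := Ideal.exists_le_maximal _ hL
  have : IsSimpleModule R (R ⧸ L) := isSimpleModule_iff_quot_maximal.2 ⟨L, hLm, ⟨.refl _ _⟩⟩
  obtain ⟨j, hj⟩ := hR.exists_injective_of_isSimpleModule K (R ⧸ L)
  obtain ⟨f, hf⟩ := hR.extension_property
    ((LinearMap.ker (LinearMap.toSpanSingleton R M x)).liftQ _ le_rfl)
    (LinearMap.ker_eq_bot.1 (Submodule.ker_liftQ_eq_bot' _ _ rfl)) (Submodule.factor hle |> j.comp)
  refine ⟨f, fun h0 => hLm.ne_top ((Ideal.eq_top_iff_one _).2 ?_)⟩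
  have h1 := LinearMap.congr_fun hf (Submodule.Quotient.mk 1)
  simp only [LinearMap.comp_apply, Submodule.liftQ_apply, LinearMap.toSpanSingleton_apply,
    one_smul, h0] at h1
  exact (Submodule.Quotient.mk_eq_zero _).1 (hj ((h1.symm).trans (map_zero j).symm))

end Kasch

/-! ### Indecomposable modules -/

section Indecomposable

variable {R : Type*} [Ring R] {X Y : Type*} [AddCommGroup X] [Module R X]
  [AddCommGroup Y] [Module R Y]

/-- Fitting's lemma for an indecomposable module of finite length. -/
theorem isNilpotent_or_isUnit_of_indecomposable [IsArtinian R Y] [IsNoetherian R Y]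
    (hY : ∀ p q : Submodule R Y, IsCompl p q → p = ⊥ ∨ q = ⊥) (g : Module.End R Y) :
    IsNilpotent g ∨ IsUnit g := by
  obtain ⟨n, hn⟩ := Filter.eventually_atTop.1 g.eventually_isCompl_ker_pow_range_pow
  have h := hn (n + 1) (by omega)
  rcases hY _ _ h with h0 | h0
  · right
    have ht : LinearMap.range (g ^ (n + 1)) = ⊤ := by
      simpa [h0, isCompl_iff, codisjoint_iff] using h
    have hu : IsUnit (g ^ (n + 1)) :=
      (Module.End.isUnit_iff _).2 ⟨LinearMap.ker_eq_bot.1 h0, LinearMap.range_eq_top.1 ht⟩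
    exact (isUnit_pow_iff (by omega)).1 hu
  · left
    exact ⟨n + 1, LinearMap.range_eq_bot.1 h0⟩

/-- A ring whose elements are nilpotent or invertible is local. -/
theorem exists_isUnit_of_isUnit_sum {E : Type*} [Ring E] [Nontrivial E]
    (hE : ∀ g : E, IsNilpotent g ∨ IsUnit g) {ι : Type*} (s : Finset ι) (g : ι → E)
    (h : IsUnit (∑ i ∈ s, g i)) : ∃ i ∈ s, IsUnit (g i) := by
  classical
  induction s using Finset.induction_on with
  | empty => simp at h
  | insert a s ha ih =>
    rw [Finset.sum_insert ha] at h
    obtain ⟨w, hw⟩ := h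
    rcases hE (↑w⁻¹ * g a) with hn | hu
    · have h1 : (1 : E) - ↑w⁻¹ * g a = ↑w⁻¹ * ∑ i ∈ s, g i := by
        rw [← w.inv_mul, hw, mul_add]; abel
      have h2 := hn.isUnit_one_sub
      rw [h1, Units.isUnit_units_mul] at h2
      obtain ⟨i, hi, hi'⟩ := ih h2
      exact ⟨i, Finset.mem_insert_of_mem hi, hi'⟩
    · exact ⟨a, Finset.mem_insert_self _ _, by simpa using hu⟩

/-- An indecomposable summand of a finite power of `X` is a summand of `X`. -/
theorem exists_retract_of_indecomposable [IsArtinian R Y] [IsNoetherian R Y] [Nontrivial Y]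
    (hY : ∀ p q : Submodule R Y, IsCompl p q → p = ⊥ ∨ q = ⊥) {k : ℕ}
    (s : Y →ₗ[R] (Fin k → X)) (r : (Fin k → X) →ₗ[R] Y) (hrs : r ∘ₗ s = LinearMap.id) :
    ∃ (s' : Y →ₗ[R] X) (r' : X →ₗ[R] Y), r' ∘ₗ s' = LinearMap.id := by
  classical
  let g : Fin k → Module.End R Y := fun i =>
    r ∘ₗ LinearMap.single R (fun _ => X) i ∘ₗ LinearMap.proj i ∘ₗ s
  have hsum : ∑ i, g i = 1 := by
    rw [Module.End.one_eq_id, ← hrs]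
    ext y
    simp only [g, LinearMap.sum_apply, LinearMap.comp_apply, ← map_sum, LinearMap.proj_apply,
      LinearMap.coe_single, Finset.univ_sum_single]
  obtain ⟨i, -, hi⟩ := exists_isUnit_of_isUnit_sum
    (isNilpotent_or_isUnit_of_indecomposable hY) Finset.univ g (hsum ▸ isUnit_one)
  obtain ⟨w, hw⟩ := hi
  refine ⟨LinearMap.proj i ∘ₗ s,
    (↑w⁻¹ : Module.End R Y) ∘ₗ r ∘ₗ LinearMap.single R (fun _ => X) i, ?_⟩
  have : (↑w⁻¹ : Module.End R Y) * g i = 1 := by rw [← hw, w.inv_mul]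
  exact this

end Indecomposable

/-! ### Linear maps out of finitely generated modules -/

section LinearMap

variable {R : Type*} [Ring R] {M N P : Type*} [AddCommGroup M] [Module R M]
  [AddCommGroup N] [Module R N] [AddCommGroup P] [Module R P]

theorem LinearMap.apply_eq_sum_smul_single {ι : Type*} [Fintype ι] [DecidableEq ι]
    (f : (ι → R) →ₗ[R] M) (x : ι → R) : f x = ∑ i, x i • f (Pi.single i 1) := by
  conv_lhs => rw [pi_eq_sum_univ' x]
  simp

theorem LinearMap.exists_comp_eq_of_ker_le {p : M →ₗ[R] N} (hp : Function.Surjective p)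
    {q : M →ₗ[R] P} (h : LinearMap.ker p ≤ LinearMap.ker q) : ∃ g : N →ₗ[R] P, g ∘ₗ p = q := by
  refine ⟨(LinearMap.ker p).liftQ q h ∘ₗ (p.quotKerEquivOfSurjective hp).symm.toLinearMap, ?_⟩
  ext x
  have : (p.quotKerEquivOfSurjective hp).symm (p x) = (LinearMap.ker p).mkQ x := by
    rw [LinearEquiv.symm_apply_eq]; rfl
  simp [this]

end LinearMap

section HomFinite

variable (K : Type*) {R : Type*} [Field K] [Ring R] [Algebra K R] (M N : Type*)
  [AddCommGroup M] [Module R M] [AddCommGroup N] [Module R N] [Module K N] [IsScalarTower K R N]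

/-- If `M` has `k` generators then `dim Hom(M, N) ≤ k * dim N` for all `N`. -/
theorem finite_linearMap_and_finrank_le [Module.Finite R M] :
    ∃ k : ℕ, ∀ (N : Type*) [AddCommGroup N] [Module R N] [Module K N] [IsScalarTower K R N]
      [Module.Finite K N], Module.Finite K (M →ₗ[R] N) ∧
        Module.finrank K (M →ₗ[R] N) ≤ k * Module.finrank K N := by
  obtain ⟨k, p, hp⟩ := Module.Finite.exists_fin' R M
  refine ⟨k, fun N _ _ _ _ _ => ?_⟩
  let ev : (M →ₗ[R] N) →ₗ[K] (Fin k → N) :=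
    { toFun f i := f (p (Pi.single i 1))
      map_add' _ _ := rfl
      map_smul' _ _ := rfl }
  have hev : Function.Injective ev := fun f g hfg => by
    apply LinearMap.cancel_right hp |>.1
    refine LinearMap.pi_ext' fun i => LinearMap.ext_ring ?_
    exact congr_fun hfg i
  exact ⟨Module.Finite.of_injective ev hev,
    (LinearMap.finrank_le_finrank_of_injective hev).trans
    (by rw [Module.finrank_pi_fintype]; simp)⟩

instance finite_linearMap [Module.Finite R M] [Module.Finite K N] :
    Module.Finite K (M →ₗ[R] N) :=
  ((finite_linearMap_and_finrank_le K M).choose_spec N).1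

end HomFinite

/-! ### The Nakayama functor -/

section Nakayama

variable (K : Type*) {R : Type*} [Field K] [Ring R] [Algebra K R]
variable (M N P : Type*) [AddCommGroup M] [Module R M] [AddCommGroup N] [Module R N]
  [AddCommGroup P] [Module R P]

/-- The Nakayama functor on objects: `ν M = D Hom_R(M, R)`, where `D` is the `K`-dual. Right
multiplication on `R` makes `Hom_R(M, R)` a right module, hence its dual a left module. -/
def Nakayama (K R : Type*) [Field K] [Ring R] [Algebra K R]
    (M : Type*) [AddCommGroup M] [Module R M] : Type _ :=
  Module.Dual K (M →ₗ[R] R)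

namespace Nakayama

instance : AddCommGroup (Nakayama K R M) :=
  inferInstanceAs (AddCommGroup (Module.Dual K (M →ₗ[R] R)))

variable {M N P}

/-- The functional underlying an element of `ν M`. -/
def toDual : Nakayama K R M ≃+ Module.Dual K (M →ₗ[R] R) := AddEquiv.refl _

/-- The right action of `R` on `Hom_R(M, R)`. -/
def mulRight (r : R) : (M →ₗ[R] R) →ₗ[K] (M →ₗ[R] R) where
  toFun f := LinearMap.toSpanSingleton R R r ∘ₗ f
  map_add' f g := by ext; simp [add_mul]
  map_smul' c f := by ext; simp

@[simp] theorem mulRight_apply (r : R) (f : M →ₗ[R] R) (x : M) : mulRight K r f x = f x * r := rfl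

instance : Module R (Nakayama K R M) where
  smul r φ := (toDual K).symm (toDual K φ ∘ₗ mulRight K r)
  one_smul φ := by
    refine (toDual K).injective (LinearMap.ext fun f => congrArg (toDual K φ) ?_); ext; simp
  mul_smul r s φ := by
    refine (toDual K).injective (LinearMap.ext fun f => congrArg (toDual K φ) ?_)
    ext; simp [mul_assoc]
  smul_zero r := rfl
  smul_add r φ ψ := rfl
  add_smul r s φ := by
    refine (toDual K).injective (LinearMap.ext fun f => ?_)
    refine (congrArg (toDual K φ) ?_).trans (map_add (toDual K φ) _ _)
    ext; simp [mul_add]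
  zero_smul φ := by
    refine (toDual K).injective (LinearMap.ext fun f => ?_)
    refine (congrArg (toDual K φ) ?_).trans (map_zero (toDual K φ))
    ext; simp

@[simp] theorem toDual_smul (r : R) (φ : Nakayama K R M) (f : M →ₗ[R] R) :
    toDual K (r • φ) f = toDual K φ (mulRight K r f) := rfl

variable {K} in
theorem ext' {φ ψ : Nakayama K R M} (h : ∀ f, toDual K φ f = toDual K ψ f) : φ = ψ :=
  (toDual K).injective (LinearMap.ext h)

/-- Precomposition, as a map `Hom_R(N, R) → Hom_R(M, R)`. -/
def precomp (g : M →ₗ[R] N) : (N →ₗ[R] R) →ₗ[K] (M →ₗ[R] R) where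
  toFun f := f ∘ₗ g
  map_add' _ _ := rfl
  map_smul' _ _ := rfl

/-- The Nakayama functor on maps. -/
def map (g : M →ₗ[R] N) : Nakayama K R M →ₗ[R] Nakayama K R N where
  toFun φ := (toDual K).symm (toDual K φ ∘ₗ precomp K g)
  map_add' _ _ := rfl
  map_smul' _ _ := rfl

@[simp] theorem toDual_map (g : M →ₗ[R] N) (φ : Nakayama K R M) (f : N →ₗ[R] R) :
    toDual K (map K g φ) f = toDual K φ (f ∘ₗ g) := rfl

theorem map_comp (g : M →ₗ[R] N) (h : N →ₗ[R] P) : map K (h ∘ₗ g) = map K h ∘ₗ map K g := rfl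

section Exact

variable {f : M →ₗ[R] N} {g : N →ₗ[R] P}

theorem map_injective (hR : Module.Baer R R) (hf : Function.Injective f) :
    Function.Injective (map K f) := by
  rw [injective_iff_map_eq_zero]
  intro φ hφ
  refine ext' fun q => ?_
  obtain ⟨q', rfl⟩ := hR.extension_property f hf q
  exact (DFunLike.congr_fun (congrArg (toDual K) hφ) q' :)

theorem map_surjective (hg : Function.Surjective g) : Function.Surjective (map K g) := by
  intro ψ
  have hinj : Function.Injective (precomp K g) := fun a b hab =>
    (LinearMap.cancel_right hg).1 hab
  obtain ⟨φ, hφ⟩ := LinearMap.dualMap_surjective_of_injective hinj (toDual K ψ)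
  exact ⟨(toDual K).symm φ, (toDual K).injective hφ⟩

theorem map_exact (hfg : Function.Exact f g) (hg : Function.Surjective g) :
    Function.Exact (map K f) (map K g) := by
  intro φ
  constructor
  · intro h
    -- `φ` vanishes on the kernel of `precomp f`, hence factors through its range.
    have hker : ∀ q : N →ₗ[R] R, precomp K f q = 0 → toDual K φ q = 0 := by
      intro q hq
      have hle : LinearMap.ker g ≤ LinearMap.ker q := by
        intro x hx
        obtain ⟨y, rfl⟩ := (hfg x).1 hx
        exact LinearMap.congr_fun hq y
      obtain ⟨q', hq'⟩ := LinearMap.exists_comp_eq_of_ker_le hg hle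
      rw [← hq']
      exact (DFunLike.congr_fun (congrArg (toDual K) h) q' :)
    have hmem : toDual K φ ∈ LinearMap.range (precomp K f).dualMap := by
      rw [LinearMap.range_dualMap_eq_dualAnnihilator_ker, Submodule.mem_dualAnnihilator]
      exact hker
    obtain ⟨ψ, hψ⟩ := hmem
    exact ⟨(toDual K).symm ψ, (toDual K).injective hψ⟩
  · rintro ⟨ψ, rfl⟩
    rw [← LinearMap.comp_apply, ← map_comp, hfg.linearMap_comp_eq_zero]
    exact ext' fun q => by simp

end Exact

end Nakayama
end Nakayama

namespace Nakayama

variable (K : Type*) {R : Type*} [Field K] [Ring R] [Algebra K R]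
variable {M N P : Type*} [AddCommGroup M] [Module R M] [AddCommGroup N] [Module R N]
  [AddCommGroup P] [Module R P]

theorem toDual_algebraMap_smul (c : K) (φ : Nakayama K R M) (f : M →ₗ[R] R) :
    toDual K (algebraMap K R c • φ) f = c • toDual K φ f := by
  rw [toDual_smul, ← map_smul]
  congr 1
  ext x
  simp [Algebra.smul_def, Algebra.commutes]

variable [Module.Finite K R]

instance finite [Module.Finite R M] : Module.Finite R (Nakayama K R M) := by
  let _ : Module K (Nakayama K R M) := inferInstanceAs (Module K (Module.Dual K (M →ₗ[R] R)))
  have : Module.Finite K (Nakayama K R M) :=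
    inferInstanceAs (Module.Finite K (Module.Dual K (M →ₗ[R] R)))
  have : IsScalarTower K R (Nakayama K R M) :=
    IsScalarTower.of_algebraMap_smul fun c φ => ext' fun f => toDual_algebraMap_smul K c φ f
  exact Module.Finite.of_restrictScalars_finite K R _

/-- A basis of `Hom_R(M, R)` embeds a finitely generated module `M` into a free module. -/
theorem pi_finBasis_injective (hR : Module.Baer R R) [Module.Finite R M] :
    Function.Injective (LinearMap.pi (Module.finBasis K (M →ₗ[R] R)) : M →ₗ[R] (_ → R)) := by
  rw [injective_iff_map_eq_zero]
  intro x hx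
  by_contra hx0
  obtain ⟨f, hf⟩ := hR.exists_apply_ne_zero K hx0
  apply hf
  have h : ∀ i, Module.finBasis K (M →ₗ[R] R) i x = 0 := fun i => congr_fun hx i
  rw [← (Module.finBasis K (M →ₗ[R] R)).sum_repr f, LinearMap.sum_apply]
  exact Finset.sum_eq_zero fun i _ => by rw [LinearMap.smul_apply, h, smul_zero]

/-- The Nakayama functor is faithful on finitely generated modules. -/
theorem map_faithful (hR : Module.Baer R R) [Module.Finite R M] :
    Function.Injective (map K : (M →ₗ[R] N) → (Nakayama K R M →ₗ[R] Nakayama K R N)) := by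
  intro g h hgh
  ext x
  by_contra hne
  obtain ⟨f, hf⟩ := hR.exists_apply_ne_zero K (sub_ne_zero.2 hne)
  apply hf
  have : f ∘ₗ g - f ∘ₗ h = 0 := by
    rw [← Module.forall_dual_apply_eq_zero_iff K]
    intro φ
    have := DFunLike.congr_fun
      (congrArg (toDual K) (LinearMap.congr_fun hgh ((toDual K).symm φ))) f
    rw [map_sub, sub_eq_zero]
    exact this
  rw [map_sub]
  exact LinearMap.congr_fun this x

/-- The Nakayama functor is full on finitely generated modules: the `K`-dual of a map
`ν M → ν N` is a map `Hom_R(N, R) → Hom_R(M, R)` of right modules, and it comes from a map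
`M → N` because a finitely generated module is the kernel of a map between free modules. -/
theorem map_full (hR : Module.Baer R R) [Module.Finite R M] [Module.Finite R N] :
    Function.Surjective (map K : (M →ₗ[R] N) → (Nakayama K R M →ₗ[R] Nakayama K R N)) := by
  intro w
  have hθ : ∀ f : N →ₗ[R] R, ∃ t : M →ₗ[R] R,
      ∀ φ : Nakayama K R M, toDual K φ t = toDual K (w φ) f := by
    intro f
    let Φ : Module.Dual K (Module.Dual K (M →ₗ[R] R)) :=
      { toFun φ := toDual K (w ((toDual K).symm φ)) f
        map_add' φ ψ := by simp
        map_smul' c φ := by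
          have : (toDual K).symm (c • φ) = algebraMap K R c • (toDual K).symm φ :=
            ext' fun q => (toDual_algebraMap_smul K c ((toDual K).symm φ) q).symm
          rw [this, map_smul, toDual_algebraMap_smul]; rfl }
    obtain ⟨t, ht⟩ := (Module.evalEquiv K (M →ₗ[R] R)).surjective Φ
    exact ⟨t, fun φ => LinearMap.congr_fun ht (toDual K φ)⟩
  choose θ hθ using hθ
  -- `θ f` represents `f` pulled back along `w`, by reflexivity of `Hom_R(M, R)`
  have hsep : ∀ a b : M →ₗ[R] R, (∀ φ : Nakayama K R M, toDual K φ a = toDual K φ b) → a = b := by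
    intro a b h
    rw [← sub_eq_zero, ← Module.forall_dual_apply_eq_zero_iff K]
    intro φ
    rw [map_sub, sub_eq_zero]
    exact h ((toDual K).symm φ)
  let Θ : (N →ₗ[R] R) →ₗ[K] (M →ₗ[R] R) :=
    { toFun := θ
      map_add' a b := hsep _ _ fun φ => by simp [hθ]
      map_smul' c a := hsep _ _ fun φ => by simp [hθ] }
  have hΘr : ∀ r a, Θ (mulRight K r a) = mulRight K r (Θ a) := fun r a => hsep _ _ fun φ => by
    rw [← toDual_smul]
    change toDual K φ (θ _) = toDual K (r • φ) (θ a)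
    rw [hθ, hθ, map_smul, toDual_smul]
  let b := Module.finBasis K (N →ₗ[R] R)
  let ι : N →ₗ[R] (Fin _ → R) := LinearMap.pi b
  have hι : Function.Injective ι := pi_finBasis_injective K hR
  let g' : M →ₗ[R] (Fin _ → R) := LinearMap.pi fun i => Θ (b i)
  have hg' : ∀ x, g' x ∈ LinearMap.range ι := by
    intro x
    by_contra hx
    obtain ⟨f, hf⟩ := hR.exists_apply_ne_zero K
      (x := (LinearMap.range ι).mkQ (g' x)) (by simpa [Submodule.Quotient.mk_eq_zero] using hx)
    apply hf
    let q := f ∘ₗ (LinearMap.range ι).mkQ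
    -- `q` is a linear relation between the coordinates of `N`
    have h0 : ∑ i, mulRight K (q (Pi.single i 1)) (b i) = 0 := by
      ext y
      have h1 : q (ι y) = 0 := by
        have : (LinearMap.range ι).mkQ (ι y) = 0 := by simp [Submodule.Quotient.mk_eq_zero]
        rw [LinearMap.comp_apply, this, map_zero]
      rw [LinearMap.apply_eq_sum_smul_single] at h1
      simpa [ι, LinearMap.sum_apply] using h1
    have h2 := LinearMap.congr_fun (congrArg Θ h0) x
    simp only [map_sum, hΘr, LinearMap.sum_apply, mulRight_apply, map_zero,
      LinearMap.zero_apply] at h2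
    change q (g' x) = 0
    rw [LinearMap.apply_eq_sum_smul_single]
    exact h2
  let g : M →ₗ[R] N := (LinearEquiv.ofInjective ι hι).symm.toLinearMap ∘ₗ g'.codRestrict _ hg'
  have hg : ∀ x, ι (g x) = g' x := fun x => by
    have := (LinearEquiv.ofInjective ι hι).apply_symm_apply (g'.codRestrict _ hg' x)
    exact congrArg Subtype.val this
  have hΘ : Θ = precomp K g := b.ext fun i => by
    ext x
    exact (congr_fun (hg x) i).symm
  refine ⟨g, LinearMap.ext fun φ => ext' fun f => ?_⟩
  rw [← hθ]
  exact (congrArg (toDual K φ) (LinearMap.congr_fun hΘ f)).symm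

/-- The Nakayama functor sends simple modules to simple modules: for simple `S`, injectivity of
`R` makes every nonzero map `S → R` generate the right module `Hom_R(S, R)`. -/
theorem isSimpleModule (hR : Module.Baer R R) (S : Type*) [AddCommGroup S] [Module R S]
    [IsSimpleModule R S] : IsSimpleModule R (Nakayama K R S) := by
  rw [isSimpleModule_iff_toSpanSingleton_surjective]
  obtain ⟨f₀, hf₀⟩ := hR.exists_injective_of_isSimpleModule K S
  have := IsSimpleModule.nontrivial R S
  have hf₀0 : f₀ ≠ 0 := by
    rintro rfl
    obtain ⟨x, hx⟩ := exists_ne (0 : S)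
    exact hx (hf₀ (by simp))
  constructor
  · have : Nontrivial (S →ₗ[R] R) := ⟨f₀, 0, hf₀0⟩
    exact inferInstanceAs (Nontrivial (Module.Dual K (S →ₗ[R] R)))
  · intro φ hφ
    -- the orbit `R φ` is a `K`-subspace of a dual space with trivial common kernel
    let W : Submodule K (Module.Dual K (S →ₗ[R] R)) :=
      { carrier := {ψ | ∃ r : R, r • φ = (toDual K).symm ψ}
        add_mem' := by
          rintro _ _ ⟨r, hr⟩ ⟨s, hs⟩
          exact ⟨r + s, by rw [add_smul, hr, hs]; rfl⟩
        zero_mem' := ⟨0, by rw [zero_smul]; rfl⟩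
        smul_mem' := by
          rintro c ψ ⟨r, hr⟩
          refine ⟨algebraMap K R c * r, ?_⟩
          rw [mul_smul, hr]
          exact ext' fun q => toDual_algebraMap_smul K c _ q }
    have hW : W = ⊤ := by
      rw [← Subspace.dualCoannihilator_dualAnnihilator_eq (W := W)]
      have : W.dualCoannihilator = ⊥ := by
        rw [eq_bot_iff]
        intro f hf
        rw [Submodule.mem_dualCoannihilator] at hf
        by_contra hf0
        have hfi : Function.Injective f :=
          (LinearMap.injective_or_eq_zero f).resolve_right hf0
        apply hφ
        refine ext' fun q => ?_
        obtain ⟨h, hh⟩ := hR.extension_property f hfi q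
        have hq : mulRight K (h 1) f = q := by
          rw [← hh]; ext x
          simpa using (h.map_smul (f x) 1).symm
        have := hf (toDual K (h 1 • φ)) ⟨h 1, rfl⟩
        rw [toDual_smul, hq] at this
        exact this
      rw [this, Submodule.dualAnnihilator_bot]
    intro ψ
    obtain ⟨r, hr⟩ := (hW ▸ Submodule.mem_top : toDual K ψ ∈ W)
    exact ⟨r, hr⟩

end Nakayama

namespace Nakayama

variable (K : Type*) {R : Type*} [Field K] [Ring R] [Algebra K R]
variable {M N P : Type*} [AddCommGroup M] [Module R M] [AddCommGroup N] [Module R N]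
  [Module K N] [IsScalarTower K R N] [AddCommGroup P] [Module R P]

/-- The map `D Hom_R(P, N) → Hom_R(N, ν P)` sending `λ` to `x ↦ (f ↦ λ (p ↦ f p • x))`. -/
def ofDualHom (l : Module.Dual K (P →ₗ[R] N)) : N →ₗ[R] Nakayama K R P where
  toFun x := (toDual K).symm
    { toFun f := l (LinearMap.toSpanSingleton R N x ∘ₗ f)
      map_add' f g := by rw [← map_add]; congr 1; ext; simp [add_smul]
      map_smul' c f := by
        rw [RingHom.id_apply, ← map_smul]; congr 1; ext; simp }
  map_add' x y := by
    refine ext' fun f => ?_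
    change l _ = l _ + l _
    rw [← map_add]; congr 1; ext; simp
  map_smul' r x := by
    refine ext' fun f => ?_
    change l _ = l _
    congr 1; ext; simp [mul_smul]

@[simp] theorem toDual_ofDualHom (l : Module.Dual K (P →ₗ[R] N)) (x : N) (f : P →ₗ[R] R) :
    toDual K (ofDualHom K l x) f = l (LinearMap.toSpanSingleton R N x ∘ₗ f) := rfl

/-- For `P` finitely generated projective, `D Hom_R(P, N) → Hom_R(N, ν P)` is surjective. -/
theorem ofDualHom_surjective [Module.Finite R P] [Module.Projective R P] :
    Function.Surjective (ofDualHom K : Module.Dual K (P →ₗ[R] N) → (N →ₗ[R] Nakayama K R P)) := by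
  intro w
  obtain ⟨k, p, hp⟩ := Module.Finite.exists_fin' R P
  obtain ⟨s, hs⟩ := Module.projective_lifting_property p LinearMap.id hp
  -- `x i`, `f i` form a dual basis of `P`
  let x : Fin k → P := fun i => p (Pi.single i 1)
  let f : Fin k → (P →ₗ[R] R) := fun i => LinearMap.proj i ∘ₗ s
  have hxf : ∀ y, ∑ i, f i y • x i = y := fun y => by
    conv_rhs => rw [← LinearMap.id_apply (R := R) y, ← hs, LinearMap.comp_apply,
      LinearMap.apply_eq_sum_smul_single]
    rfl
  refine ⟨{ toFun g := ∑ i, toDual K (w (g (x i))) (f i)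
            map_add' g h := by simp [Finset.sum_add_distrib]
            map_smul' c g := by
              rw [RingHom.id_apply, Finset.smul_sum]
              refine Finset.sum_congr rfl fun i _ => ?_
              rw [LinearMap.smul_apply, ← algebraMap_smul R c (g (x i)), map_smul,
                toDual_algebraMap_smul] }, ?_⟩
  refine LinearMap.ext fun y => ext' fun q => ?_
  simp only [toDual_ofDualHom, LinearMap.coe_mk, AddHom.coe_mk, LinearMap.comp_apply,
    LinearMap.toSpanSingleton_apply, map_smul, toDual_smul]
  rw [← map_sum]
  congr 1
  ext z
  conv_rhs => rw [← hxf z]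
  simp [LinearMap.sum_apply]

/-- `ν P` is injective for `P` finitely generated projective. -/
theorem exists_extension [Module.Finite R P] [Module.Projective R P] [Module K M]
    [IsScalarTower K R M] (j : N →ₗ[R] M)
    (hj : Function.Injective j) (w : N →ₗ[R] Nakayama K R P) :
    ∃ w' : M →ₗ[R] Nakayama K R P, w' ∘ₗ j = w := by
  obtain ⟨l, rfl⟩ := ofDualHom_surjective K w
  let J : (P →ₗ[R] N) →ₗ[K] (P →ₗ[R] M) :=
    { toFun f := j ∘ₗ f
      map_add' f g := by ext; simp
      map_smul' c f := by
        ext y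
        simp only [LinearMap.comp_apply, LinearMap.smul_apply, RingHom.id_apply]
        rw [← algebraMap_smul R c, map_smul, algebraMap_smul] }
  have hJ : Function.Injective J := fun f g h => (LinearMap.cancel_left hj).1 h
  obtain ⟨l', rfl⟩ := LinearMap.dualMap_surjective_of_injective hJ l
  refine ⟨ofDualHom K l', LinearMap.ext fun x => ext' fun f => ?_⟩
  change l' _ = l' _
  congr 1
  ext y
  simp [J]

/-- `ν P` is projective for `P` finitely generated projective over a selfinjective algebra. -/
theorem projective [Module.Finite K R] (hR : Module.Baer R R) [Module.Finite R P]
    [Module.Projective R P] : Module.Projective R (Nakayama K R P) := by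
  let _ : Module K (Nakayama K R P) := Module.restrictScalars K R _
  have : IsScalarTower K R (Nakayama K R P) := IsScalarTower.restrictScalars K R _
  obtain ⟨s, hs⟩ := exists_extension K _
    (pi_finBasis_injective K hR (M := Nakayama K R P)) (LinearMap.id)
  exact Module.Projective.of_split _ s hs

/-- Let `P₁ → P₀ → L → 0` be a projective presentation with first map `d`. If all maps `L → N`
factor through finitely generated free modules, then every map `N → ν P₀` that vanishes in `ν L`
lifts along `ν d`: regarded as an element of `D Hom(P₀, N)`, it kills the maps that factor through
`L`, hence extends to `D Hom(P₁, N)`. -/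
theorem exists_lift_of_factors {P₀ P₁ L : Type*} [AddCommGroup P₀] [Module R P₀] [AddCommGroup P₁]
    [Module R P₁] [AddCommGroup L] [Module R L] [Module.Finite R P₀] [Module.Projective R P₀]
    (d : P₁ →ₗ[R] P₀) (p : P₀ →ₗ[R] L) (hdp : Function.Exact d p) (hp : Function.Surjective p)
    (hfac : ∀ g : L →ₗ[R] N, ∃ (k : ℕ) (a : L →ₗ[R] (Fin k → R)) (b : (Fin k → R) →ₗ[R] N),
      g = b ∘ₗ a)
    (w : N →ₗ[R] Nakayama K R P₀) (hw : map K p ∘ₗ w = 0) :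
    ∃ w' : N →ₗ[R] Nakayama K R P₁, map K d ∘ₗ w' = w := by
  obtain ⟨l, rfl⟩ := ofDualHom_surjective K w
  let D : (P₀ →ₗ[R] N) →ₗ[K] (P₁ →ₗ[R] N) :=
    { toFun f := f ∘ₗ d
      map_add' f g := rfl
      map_smul' c f := rfl }
  have hmem : l ∈ LinearMap.range D.dualMap := by
    rw [LinearMap.range_dualMap_eq_dualAnnihilator_ker, Submodule.mem_dualAnnihilator]
    intro q hq
    have hle : LinearMap.ker p ≤ LinearMap.ker q := by
      intro x hx
      obtain ⟨y, rfl⟩ := (hdp x).1 hx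
      exact LinearMap.congr_fun hq y
    obtain ⟨g, rfl⟩ := LinearMap.exists_comp_eq_of_ker_le hp hle
    obtain ⟨k, a, b, rfl⟩ := hfac g
    have hsum : (b ∘ₗ a) ∘ₗ p = ∑ i, LinearMap.toSpanSingleton R N (b (Pi.single i 1)) ∘ₗ
        ((LinearMap.proj i ∘ₗ a) ∘ₗ p) := by
      ext x
      simp only [LinearMap.comp_apply, LinearMap.sum_apply]
      rw [LinearMap.apply_eq_sum_smul_single b]
      rfl
    rw [hsum, map_sum]
    refine Finset.sum_eq_zero fun i _ => ?_
    exact DFunLike.congr_fun (congrArg (toDual K) (LinearMap.congr_fun hw (b (Pi.single i 1))))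
      (LinearMap.proj i ∘ₗ a)
  obtain ⟨l', rfl⟩ := hmem
  exact ⟨ofDualHom K l', LinearMap.ext fun x => ext' fun f => rfl⟩

end Nakayama

/-! ### Dimensions of extension groups and of stable morphism spaces -/

section ExtDimension

open Abelian

universe w v' u'

variable (K : Type*) [Field K] {C : Type u'} [Category.{v'} C] [Abelian C] [Linear K C]

section Sequences

variable [HasExt.{w} C] {S : ShortComplex C} (hS : S.ShortExact) (Y : C)

/-- The connecting map `Ext^i(X₁, Y) → Ext^{i+1}(X₃, Y)`. -/
noncomputable abbrev extDelta (i : ℕ) : Ext S.X₁ Y i →ₗ[K] Ext S.X₃ Y (i + 1) :=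
  hS.extClass.precompOfLinear K Y (add_comm 1 i)

/-- The connecting map `Ext^i(Y, X₃) → Ext^{i+1}(Y, X₁)`. -/
noncomputable abbrev extDelta' (i : ℕ) : Ext Y S.X₃ i →ₗ[K] Ext Y S.X₁ (i + 1) :=
  hS.extClass.postcompOfLinear K Y rfl

theorem extDelta_surjective (i : ℕ) [Subsingleton (Ext S.X₂ Y (i + 1))] :
    Function.Surjective (extDelta K hS Y i) := fun x =>
  Ext.contravariant_sequence_exact₃ hS Y x (Subsingleton.elim _ _) (add_comm 1 i)

theorem extDelta_injective (i : ℕ) [Subsingleton (Ext S.X₂ Y i)] :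
    Function.Injective (extDelta K hS Y i) := by
  rw [injective_iff_map_eq_zero]
  intro x hx
  obtain ⟨y, rfl⟩ := Ext.contravariant_sequence_exact₁ hS Y x (add_comm 1 i) hx
  rw [Subsingleton.elim y 0, Ext.comp_zero]

theorem extDelta'_surjective (i : ℕ) [Subsingleton (Ext Y S.X₂ (i + 1))] :
    Function.Surjective (extDelta' K hS Y i) := fun x =>
  Ext.covariant_sequence_exact₁ Y hS x (Subsingleton.elim _ _) rfl

theorem extDelta'_injective (i : ℕ) [Subsingleton (Ext Y S.X₂ i)] :
    Function.Injective (extDelta' K hS Y i) := by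
  rw [injective_iff_map_eq_zero]
  intro x hx
  obtain ⟨y, rfl⟩ := Ext.covariant_sequence_exact₃ Y hS x rfl hx
  rw [Subsingleton.elim y 0, Ext.zero_comp]

theorem finrank_ext_le_add {S : ShortComplex C} (hS : S.ShortExact) (Y : C) (i : ℕ)
    [Module.Finite K (Ext S.X₁ Y i)]
    [Module.Finite K (Ext S.X₂ Y (i + 1))] [Module.Finite K (Ext S.X₃ Y (i + 1))] :
    Module.finrank K (Ext S.X₃ Y (i + 1)) ≤
      Module.finrank K (Ext S.X₁ Y i) + Module.finrank K (Ext S.X₂ Y (i + 1)) := by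
  let g : Ext S.X₃ Y (i + 1) →ₗ[K] Ext S.X₂ Y (i + 1) :=
    (Ext.mk₀ S.g).precompOfLinear K Y (zero_add _)
  have hle : LinearMap.ker g ≤ LinearMap.range (extDelta K hS Y i) := fun x hx =>
    Ext.contravariant_sequence_exact₃ hS Y x hx (add_comm 1 i)
  have h1 := g.finrank_range_add_finrank_ker
  have h2 := (Submodule.finrank_mono hle).trans (LinearMap.finrank_range_le _)
  have h3 := (LinearMap.range g).finrank_le
  omega

/-- The Euler characteristic of `0 → Hom(X₃, Y) → Hom(X₂, Y) → Hom(X₁, Y) → Ext¹(X₃, Y) → 0`. -/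
theorem finrank_ext_one_add {S : ShortComplex C} (hS : S.ShortExact) (Y : C)
    [Projective S.X₂] [Module.Finite K (S.X₁ ⟶ Y)]
    [Module.Finite K (S.X₂ ⟶ Y)] :
    Module.finrank K (Ext S.X₃ Y 1) + Module.finrank K (S.X₂ ⟶ Y) =
      Module.finrank K (S.X₁ ⟶ Y) + Module.finrank K (S.X₃ ⟶ Y) := by
  have := hS.epi_g
  have : Subsingleton (Ext S.X₂ Y (0 + 1)) := Ext.subsingleton_of_projective _ _ _
  let f : (S.X₂ ⟶ Y) →ₗ[K] (S.X₁ ⟶ Y) := Linear.leftComp K Y S.f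
  let g : (S.X₃ ⟶ Y) →ₗ[K] (S.X₂ ⟶ Y) := Linear.leftComp K Y S.g
  let d : (S.X₁ ⟶ Y) →ₗ[K] Ext S.X₃ Y 1 :=
    extDelta K hS Y 0 ∘ₗ (Ext.linearEquiv₀ (R := K) (X := S.X₁) (Y := Y)).symm.toLinearMap
  have hd : Function.Surjective d :=
    (extDelta_surjective K hS Y 0).comp (LinearEquiv.surjective _)
  have hg : Function.Injective g := fun a b h => (cancel_epi S.g).1 h
  have hfg : LinearMap.ker f = LinearMap.range g := by
    ext x
    constructor
    · intro hx
      obtain ⟨l, hl⟩ := hS.exact.desc' x hx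
      exact ⟨l, hl⟩
    · rintro ⟨y, rfl⟩
      change S.f ≫ S.g ≫ y = 0
      rw [S.zero_assoc, Limits.zero_comp]
  have hdf : LinearMap.ker d = LinearMap.range f := by
    ext x
    constructor
    · intro hx
      obtain ⟨y, hy⟩ := Ext.contravariant_sequence_exact₁ hS Y (Ext.mk₀ x) (add_comm 1 0) hx
      obtain ⟨y, rfl⟩ := Ext.addEquiv₀.symm.surjective y
      exact ⟨y, Ext.addEquiv₀.symm.injective ((Ext.mk₀_comp_mk₀ _ _).symm.trans hy)⟩
    · rintro ⟨y, rfl⟩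
      change hS.extClass.comp (Ext.mk₀ (S.f ≫ y)) (add_comm 1 0) = 0
      rw [← Ext.mk₀_comp_mk₀, ← Ext.comp_assoc hS.extClass (Ext.mk₀ S.f) (Ext.mk₀ y)
        (add_zero 1) (zero_add 0) (by omega), hS.extClass_comp, Ext.zero_comp]
  have h1 := d.finrank_range_add_finrank_ker
  have h2 := f.finrank_range_add_finrank_ker
  rw [LinearMap.range_eq_top.2 hd, finrank_top, hdf] at h1
  rw [hfg, LinearMap.finrank_range_of_inj hg] at h2
  omega

end Sequences

section Summands

variable [HasExt.{w} C] {ι : Type*} [Fintype ι] {Y : C} {X : ι → C}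
  (a : ∀ i, Y ⟶ X i) (b : ∀ i, X i ⟶ Y)

theorem ext_eq_zero_of_sum_eq_id (hab : ∑ i, a i ≫ b i = 𝟙 Y) {S : C} {n : ℕ} (x : Ext Y S n)
    (hx : ∀ i, (Ext.mk₀ (b i)).comp x (zero_add n) = 0) : x = 0 := by
  rw [← Ext.mk₀_id_comp x, ← hab, Ext.mk₀_sum, Ext.sum_comp]
  refine Finset.sum_eq_zero fun i _ => ?_
  rw [← Ext.mk₀_comp_mk₀_assoc, hx, Ext.comp_zero]

theorem finrank_ext_le_sum (hab : ∑ i, a i ≫ b i = 𝟙 Y) (S : C) (n : ℕ)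
    [∀ i, Module.Finite K (Ext (X i) S n)] :
    Module.finrank K (Ext Y S n) ≤ ∑ i, Module.finrank K (Ext (X i) S n) := by
  let f : Ext Y S n →ₗ[K] (∀ i, Ext (X i) S n) :=
    LinearMap.pi fun i => (Ext.mk₀ (b i)).precompOfLinear K S (zero_add n)
  have hf : Function.Injective f := by
    rw [injective_iff_map_eq_zero]
    exact fun x hx => ext_eq_zero_of_sum_eq_id a b hab x fun i => congr_fun hx i
  exact (LinearMap.finrank_le_finrank_of_injective hf).trans (Module.finrank_pi_fintype K).le

end Summands

section Stable

variable [EnoughProjectives C]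

/-- The maps `M ⟶ N` that factor through a projective object; equivalently, through the fixed
epimorphism from a projective object onto `N`. -/
noncomputable def projectiveMaps (M N : C) : Submodule K (M ⟶ N) :=
  LinearMap.range (Linear.rightComp K M (Projective.π N))

theorem comp_mem_projectiveMaps {M P N : C} [Projective P] (a : M ⟶ P) (b : P ⟶ N) :
    a ≫ b ∈ projectiveMaps K M N :=
  ⟨a ≫ Projective.factorThru b (Projective.π N), by simp⟩

theorem comp_comp_mem_projectiveMaps {M M' N N' : C} (a : M' ⟶ M) {f : M ⟶ N} (b : N ⟶ N')
    (hf : f ∈ projectiveMaps K M N) : a ≫ f ≫ b ∈ projectiveMaps K M' N' := by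
  obtain ⟨g, rfl⟩ := hf
  have := comp_mem_projectiveMaps K (a ≫ g) (Projective.π N ≫ b)
  simpa using this

/-- The dimension of the space of maps `M ⟶ N` modulo those factoring through a projective. -/
noncomputable def stableDim (M N : C) : ℕ := Module.finrank K ((M ⟶ N) ⧸ projectiveMaps K M N)

theorem stableDim_eq_finrank_ext [HasExt.{w} C] {S : ShortComplex C} (hS : S.ShortExact) (M : C)
    [Projective S.X₂] [Subsingleton (Ext M S.X₂ 1)] :
    stableDim K M S.X₃ = Module.finrank K (Ext M S.X₁ 1) := by
  have := hS.epi_g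
  let d : (M ⟶ S.X₃) →ₗ[K] Ext M S.X₁ 1 :=
    extDelta' K hS M 0 ∘ₗ (Ext.linearEquiv₀ (R := K) (X := M) (Y := S.X₃)).symm.toLinearMap
  have hd : Function.Surjective d :=
    (extDelta'_surjective K hS M 0).comp (LinearEquiv.surjective _)
  have hker : LinearMap.ker d = projectiveMaps K M S.X₃ := by
    ext x
    constructor
    · intro hx
      obtain ⟨y, hy⟩ := Ext.covariant_sequence_exact₃ M hS (Ext.mk₀ x) rfl hx
      obtain ⟨y, rfl⟩ := Ext.addEquiv₀.symm.surjective y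
      have : y ≫ S.g = x := Ext.addEquiv₀.symm.injective ((Ext.mk₀_comp_mk₀ _ _).symm.trans hy)
      rw [← this]
      exact comp_mem_projectiveMaps K _ _
    · rintro ⟨y, rfl⟩
      have h0 : y ≫ Projective.π S.X₃ =
          (y ≫ Projective.factorThru (Projective.π S.X₃) S.g) ≫ S.g := by simp
      change (Ext.mk₀ (y ≫ Projective.π S.X₃)).comp hS.extClass rfl = 0
      rw [h0, ← Ext.mk₀_comp_mk₀, Ext.comp_assoc (Ext.mk₀ _) (Ext.mk₀ S.g) hS.extClass
        (zero_add 0) (zero_add 1) (by omega), hS.comp_extClass, Ext.comp_zero]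
  rw [stableDim, ← hker]
  exact (d.quotKerEquivOfSurjective hd).finrank_eq

/-- The stable endomorphism algebra of a direct sum contains those of its summands. -/
theorem stableDim_add_le {Y Y₁ Y₂ : C} [Module.Finite K (Y ⟶ Y)] (a₁ : Y₁ ⟶ Y) (b₁ : Y ⟶ Y₁)
    (a₂ : Y₂ ⟶ Y) (b₂ : Y ⟶ Y₂) (h₁ : a₁ ≫ b₁ = 𝟙 _) (h₂ : a₂ ≫ b₂ = 𝟙 _)
    (h₁₂ : a₁ ≫ b₂ = 0) (h₂₁ : a₂ ≫ b₁ = 0) :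
    stableDim K Y₁ Y₁ + stableDim K Y₂ Y₂ ≤ stableDim K Y Y := by
  let f₁ : (Y₁ ⟶ Y₁) →ₗ[K] (Y ⟶ Y) := Linear.leftComp K _ b₁ ∘ₗ Linear.rightComp K _ a₁
  let f₂ : (Y₂ ⟶ Y₂) →ₗ[K] (Y ⟶ Y) := Linear.leftComp K _ b₂ ∘ₗ Linear.rightComp K _ a₂
  have m₁ : projectiveMaps K Y₁ Y₁ ≤ (projectiveMaps K Y Y).comap f₁ := fun x hx =>
    comp_comp_mem_projectiveMaps K b₁ a₁ hx
  have m₂ : projectiveMaps K Y₂ Y₂ ≤ (projectiveMaps K Y Y).comap f₂ := fun x hx =>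
    comp_comp_mem_projectiveMaps K b₂ a₂ hx
  let F := ((projectiveMaps K Y₁ Y₁).mapQ _ f₁ m₁).coprod ((projectiveMaps K Y₂ Y₂).mapQ _ f₂ m₂)
  have hF : Function.Injective F := by
    rw [injective_iff_map_eq_zero]
    rintro ⟨x₁, x₂⟩ hx
    obtain ⟨x₁, rfl⟩ := Submodule.mkQ_surjective _ x₁
    obtain ⟨x₂, rfl⟩ := Submodule.mkQ_surjective _ x₂
    have hx' : b₁ ≫ x₁ ≫ a₁ + b₂ ≫ x₂ ≫ a₂ ∈ projectiveMaps K Y Y :=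
      (Submodule.Quotient.mk_eq_zero _).1 hx
    have e₁ := comp_comp_mem_projectiveMaps K a₁ b₁ hx'
    have e₂ := comp_comp_mem_projectiveMaps K a₂ b₂ hx'
    simp only [Preadditive.add_comp, Category.assoc, h₁, h₂, h₁₂, h₂₁,
      Category.comp_id, Limits.comp_zero, add_zero, zero_add, reassoc_of% h₁, reassoc_of% h₂]
      at e₁ e₂
    exact Prod.ext ((Submodule.Quotient.mk_eq_zero _).2 e₁)
      ((Submodule.Quotient.mk_eq_zero _).2 e₂)
  have hfin : Module.Finite K (((Y₁ ⟶ Y₁) ⧸ projectiveMaps K Y₁ Y₁) ×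
      ((Y₂ ⟶ Y₂) ⧸ projectiveMaps K Y₂ Y₂)) := Module.Finite.of_injective F hF
  have hfin₁ := Module.Finite.of_surjective (LinearMap.fst K ((Y₁ ⟶ Y₁) ⧸ projectiveMaps K Y₁ Y₁)
    ((Y₂ ⟶ Y₂) ⧸ projectiveMaps K Y₂ Y₂)) Prod.fst_surjective
  have hfin₂ := Module.Finite.of_surjective (LinearMap.snd K ((Y₁ ⟶ Y₁) ⧸ projectiveMaps K Y₁ Y₁)
    ((Y₂ ⟶ Y₂) ⧸ projectiveMaps K Y₂ Y₂)) Prod.snd_surjective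
  rw [stableDim, stableDim, ← Module.finrank_prod]
  exact LinearMap.finrank_le_finrank_of_injective hF

theorem projective_of_stableDim_eq_zero {Y : C} [Module.Finite K (Y ⟶ Y)]
    (h : stableDim K Y Y = 0) : Projective Y := by
  have := Module.finrank_zero_iff.1 h
  obtain ⟨g, hg⟩ : 𝟙 Y ∈ projectiveMaps K Y Y :=
    (Submodule.Quotient.mk_eq_zero _).1 (Subsingleton.elim _ _)
  exact (Retract.mk g (Projective.π Y) hg).projective

end Stable

end ExtDimension

/-! ### Syzygies and dimension shifting -/

section Syzygies

open Abelian
open scoped ModuleCat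

variable {R : Type v} [Ring R]

/-- `Z` is a syzygy of `M`: there is a short exact sequence `0 → Z → P → M → 0` with `P` finitely
generated projective. The sequence is not required to be minimal. -/
def IsSyzygy (Z M : ModuleCat.{v} R) : Prop :=
  ∃ (P : ModuleCat.{v} R) (f : Z ⟶ P) (g : P ⟶ M) (w : f ≫ g = 0),
    Module.Finite R P ∧ Projective P ∧ (ShortComplex.mk f g w).ShortExact

theorem exists_isSyzygy [IsNoetherianRing R] (M : ModuleCat.{v} R) [Module.Finite R M] :
    ∃ Z : ModuleCat.{v} R, Module.Finite R Z ∧ IsSyzygy Z M := by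
  obtain ⟨k, p, hp⟩ := Module.Finite.exists_fin' R M
  have := LinearMap.shortExact_shortComplexKer hp
  exact ⟨ModuleCat.of R (LinearMap.ker p), inferInstance, ModuleCat.of R (Fin k → R), _, _,
    p.shortComplexKer.zero, inferInstance, (IsProjective.iff_projective _).1 inferInstance, this⟩

theorem ModuleCat.projective_module (P : ModuleCat.{v} R) [Projective P] : Module.Projective R P :=
  (IsProjective.iff_projective _).2 ‹_›

/-- Over a selfinjective ring, finitely generated projective modules are injective. -/
theorem Module.Baer.injective_of_projective (hR : Module.Baer R R) (P : ModuleCat.{v} R)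
    [Module.Finite R P] [CategoryTheory.Projective P] : CategoryTheory.Injective P := by
  obtain ⟨k, p, hp⟩ := Module.Finite.exists_fin' R P
  obtain ⟨s, hs⟩ := Module.projective_lifting_property p LinearMap.id hp
  have : Module.Injective R P := ⟨fun X Y _ _ _ _ j hj w => by
    choose e he using fun i : Fin k => hR.extension_property j hj (LinearMap.proj i ∘ₗ s ∘ₗ w)
    refine ⟨p ∘ₗ LinearMap.pi e, fun x => ?_⟩
    have : LinearMap.pi e (j x) = s (w x) := funext fun i => LinearMap.congr_fun (he i) x
    rw [LinearMap.comp_apply, this]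
    exact LinearMap.congr_fun hs (w x)⟩
  exact Module.injective_object_of_injective_module R P

variable (K : Type v) [Field K] [Algebra K R]

/-- Dimension shifting in the first variable. -/
theorem IsSyzygy.finrank_ext {Z M : ModuleCat.{v} R} (h : IsSyzygy Z M) (N : ModuleCat.{v} R)
    (i : ℕ) : Module.finrank K (Ext M N (i + 2)) = Module.finrank K (Ext Z N (i + 1)) := by
  obtain ⟨P, f, g, w, _, _, hS⟩ := h
  have : Subsingleton (Ext P N (i + 1 + 1)) := Ext.subsingleton_of_projective _ _ _
  have : Subsingleton (Ext P N (i + 1)) := Ext.subsingleton_of_projective _ _ _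
  exact (LinearEquiv.ofBijective (extDelta K hS N (i + 1))
    ⟨extDelta_injective K hS N _, extDelta_surjective K hS N _⟩).finrank_eq.symm

/-- Dimension shifting in the second variable, over a selfinjective algebra. -/
theorem IsSyzygy.finrank_ext' (hR : Module.Baer R R) {Z M : ModuleCat.{v} R} (h : IsSyzygy Z M)
    (N : ModuleCat.{v} R) (i : ℕ) :
    Module.finrank K (Ext N Z (i + 2)) = Module.finrank K (Ext N M (i + 1)) := by
  obtain ⟨P, f, g, w, _, _, hS⟩ := h
  have := hR.injective_of_projective P
  have : Subsingleton (Ext N P (i + 1 + 1)) := Ext.subsingleton_of_injective _ _ _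
  have : Subsingleton (Ext N P (i + 1)) := Ext.subsingleton_of_injective _ _ _
  exact (LinearEquiv.ofBijective (extDelta' K hS N (i + 1))
    ⟨extDelta'_injective K hS N _, extDelta'_surjective K hS N _⟩).finrank_eq.symm

theorem IsSyzygy.stableDim_eq_finrank_ext (hR : Module.Baer R R) {Z M : ModuleCat.{v} R}
    (h : IsSyzygy Z M) (N : ModuleCat.{v} R) :
    stableDim K N M = Module.finrank K (Ext N Z 1) := by
  obtain ⟨P, f, g, w, _, _, hS⟩ := h
  have := hR.injective_of_projective P
  have : Subsingleton (Ext N P 1) := Ext.subsingleton_of_injective _ _ _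
  exact _root_.stableDim_eq_finrank_ext K hS N

variable [Module.Finite K R]

theorem ModuleCat.finite_of_finite (M : ModuleCat.{v} R) [Module.Finite R M] :
    Module.Finite K M := Module.Finite.trans R M

instance ModuleCat.finite_hom (M N : ModuleCat.{v} R) [Module.Finite R M] [Module.Finite R N] :
    Module.Finite K (M ⟶ N) := by
  have := N.finite_of_finite K
  exact Module.Finite.equiv (ModuleCat.homLinearEquiv (S := K)).symm

/-- `dim Ext^i(M, N)` is at most a constant multiple of `dim N`, uniformly in `N`. -/
theorem exists_finrank_ext_le (i : ℕ) (M : ModuleCat.{v} R) [Module.Finite R M] :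
    ∃ c : ℕ, ∀ (N : ModuleCat.{v} R) [Module.Finite R N],
      Module.Finite K (Ext M N i) ∧ Module.finrank K (Ext M N i) ≤ c * Module.finrank K N := by
  have : IsArtinianRing R := IsArtinianRing.of_finite K R
  induction i generalizing M with
  | zero =>
    obtain ⟨c, hc⟩ := finite_linearMap_and_finrank_le.{v, v, v, v} K (R := R) M
    refine ⟨c, fun N _ => ?_⟩
    have := N.finite_of_finite K
    have e : Ext M N 0 ≃ₗ[K] (M →ₗ[R] N) :=
      Ext.linearEquiv₀.trans (ModuleCat.homLinearEquiv (S := K))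
    exact ⟨Module.Finite.equiv e.symm, e.finrank_eq.trans_le (hc N).2⟩
  | succ i ih =>
    obtain ⟨Z, _, P, f, g, w, _, _, hS⟩ := exists_isSyzygy M
    obtain ⟨c, hc⟩ := ih Z
    refine ⟨c, fun N _ => ?_⟩
    have : Subsingleton (Ext P N (i + 1)) := Ext.subsingleton_of_projective _ _ _
    have hs := extDelta_surjective K hS N i
    obtain ⟨h1, h2⟩ := hc N
    exact ⟨Module.Finite.of_surjective _ hs,
      (LinearMap.finrank_le_finrank_of_surjective hs).trans h2⟩

instance finite_ext (i : ℕ) (M N : ModuleCat.{v} R) [Module.Finite R M] [Module.Finite R N] :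
    Module.Finite K (Ext M N i) :=
  ((exists_finrank_ext_le K i M).choose_spec N).1

/-- Passing to a syzygy preserves the dimension of the stable endomorphism ring. -/
theorem IsSyzygy.stableDim_eq (hR : Module.Baer R R) {Z M : ModuleCat.{v} R} (h : IsSyzygy Z M)
    [Module.Finite R Z] : stableDim K Z Z = stableDim K M M := by
  have : IsArtinianRing R := IsArtinianRing.of_finite K R
  obtain ⟨Z', _, h'⟩ := exists_isSyzygy Z
  rw [h.stableDim_eq_finrank_ext K hR, h'.stableDim_eq_finrank_ext K hR, ← h.finrank_ext K,
    h'.finrank_ext' K hR]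

end Syzygies

/-! ### The Nakayama functor and extension groups -/

section NakayamaFunctor

open Abelian
open scoped ModuleCat

variable {R : Type v} [Ring R] (K : Type v) [Field K] [Algebra K R]

/-- The Nakayama functor on objects of `ModuleCat R`. -/
abbrev nakayamaObj (M : ModuleCat.{v} R) : ModuleCat.{v} R := ModuleCat.of R (Nakayama K R M)

/-- The Nakayama functor on morphisms of `ModuleCat R`, as a `K`-linear map. -/
def nakayamaMap (M N : ModuleCat.{v} R) : (M ⟶ N) →ₗ[K] (nakayamaObj K M ⟶ nakayamaObj K N) where
  toFun g := ModuleCat.ofHom (Nakayama.map K g.hom)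
  map_add' g h := by
    ext φ
    refine Nakayama.ext' fun f => ?_
    change Nakayama.toDual K φ _ = Nakayama.toDual K φ _ + Nakayama.toDual K φ _
    rw [← map_add]; congr 1; ext x
    exact f.map_add _ _
  map_smul' c g := by
    ext φ
    refine Nakayama.ext' fun f => ?_
    change _ = Nakayama.toDual K (algebraMap K R c • Nakayama.map K g.hom φ) f
    rw [Nakayama.toDual_algebraMap_smul]
    change Nakayama.toDual K φ _ = c • Nakayama.toDual K φ _
    rw [← map_smul]; congr 1; ext x
    change f (algebraMap K R c • g.hom x) = c • f (g.hom x)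
    rw [map_smul, algebraMap_smul]

theorem shortExact_nakayama (hR : Module.Baer R R) {Z P M : ModuleCat.{v} R} (f : Z ⟶ P)
    (g : P ⟶ M) (w : f ≫ g = 0) (hS : (ShortComplex.mk f g w).ShortExact) :
    ∃ w', (ShortComplex.mk (nakayamaMap K Z P f) (nakayamaMap K P M g) w').ShortExact := by
  have hg : Function.Surjective g.hom := (ModuleCat.epi_iff_surjective _).1 hS.epi_g
  have hf : Function.Injective f.hom := (ModuleCat.mono_iff_injective _).1 hS.mono_f
  have hfg : Function.Exact f.hom g.hom :=
    (ShortComplex.ShortExact.moduleCat_exact_iff_function_exact _).1 hS.exact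
  have hex := Nakayama.map_exact K hfg hg
  exact ⟨ModuleCat.hom_ext hex.linearMap_comp_eq_zero, ModuleCat.shortComplex_shortExact _ hex
    (Nakayama.map_injective K hR hf) (Nakayama.map_surjective K hg)⟩

variable [Module.Finite K R]

theorem finrank_hom_nakayamaObj (hR : Module.Baer R R) (M N : ModuleCat.{v} R) [Module.Finite R M]
    [Module.Finite R N] :
    Module.finrank K (nakayamaObj K M ⟶ nakayamaObj K N) = Module.finrank K (M ⟶ N) := by
  refine (LinearEquiv.ofBijective (nakayamaMap K M N)
    ⟨fun g h hgh => ?_, fun w => ?_⟩).finrank_eq.symm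
  · exact ModuleCat.hom_ext (Nakayama.map_faithful K hR (congrArg ModuleCat.Hom.hom hgh))
  · obtain ⟨g, hg⟩ := Nakayama.map_full K hR w.hom
    exact ⟨ModuleCat.ofHom g, ModuleCat.hom_ext hg⟩

theorem IsSyzygy.nakayamaObj (hR : Module.Baer R R) {Z M : ModuleCat.{v} R} (h : IsSyzygy Z M) :
    IsSyzygy (nakayamaObj K Z) (nakayamaObj K M) := by
  obtain ⟨P, f, g, w, _, _, hS⟩ := h
  obtain ⟨w', hS'⟩ := shortExact_nakayama K hR f g w hS
  exact ⟨_, _, _, w', inferInstance,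
    (IsProjective.iff_projective _).1 (Nakayama.projective K hR), hS'⟩

/-- The Nakayama functor preserves the dimensions of `Ext` groups, because it is exact and fully
faithful and preserves projectives. -/
theorem finrank_ext_nakayamaObj (hR : Module.Baer R R) (i : ℕ) (M N : ModuleCat.{v} R)
    [Module.Finite R M] [Module.Finite R N] :
    Module.finrank K (Ext (nakayamaObj K M) (nakayamaObj K N) (i + 1)) =
      Module.finrank K (Ext M N (i + 1)) := by
  have : IsArtinianRing R := IsArtinianRing.of_finite K R
  induction i generalizing M with
  | zero =>
    obtain ⟨Z, _, P, f, g, w, _, _, hS⟩ := exists_isSyzygy M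
    obtain ⟨w', hS'⟩ := shortExact_nakayama K hR f g w hS
    have : Projective (nakayamaObj K P) :=
      (IsProjective.iff_projective _).1 (Nakayama.projective K hR)
    have h1 : Module.finrank K (Ext M N (0 + 1)) + Module.finrank K (P ⟶ N) =
      Module.finrank K (Z ⟶ N) + Module.finrank K (M ⟶ N) := finrank_ext_one_add K hS N
    have h2 : Module.finrank K (Ext (nakayamaObj K M) (nakayamaObj K N) (0 + 1)) +
        Module.finrank K (nakayamaObj K P ⟶ nakayamaObj K N) =
      Module.finrank K (nakayamaObj K Z ⟶ nakayamaObj K N) +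
        Module.finrank K (nakayamaObj K M ⟶ nakayamaObj K N) := finrank_ext_one_add K hS' _
    simp only [finrank_hom_nakayamaObj K hR] at h2
    omega
  | succ i ih =>
    obtain ⟨Z, _, h⟩ := exists_isSyzygy M
    rw [h.finrank_ext K, (h.nakayamaObj K hR).finrank_ext K, ih]

theorem stableDim_nakayamaObj (hR : Module.Baer R R) (M : ModuleCat.{v} R) [Module.Finite R M] :
    stableDim K (nakayamaObj K M) (nakayamaObj K M) = stableDim K M M := by
  have : IsArtinianRing R := IsArtinianRing.of_finite K R
  obtain ⟨Z, _, h⟩ := exists_isSyzygy M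
  rw [h.stableDim_eq_finrank_ext K hR, (h.nakayamaObj K hR).stableDim_eq_finrank_ext K hR]
  exact finrank_ext_nakayamaObj K hR 0 M Z

/-- The vanishing half of the Auslander–Reiten formula. If `Z` is a second syzygy of `L` and every
map `L → N` factors through a finitely generated free module, then `Ext¹(N, ν Z) = 0`. -/
theorem subsingleton_ext_nakayamaObj (hR : Module.Baer R R) {L Z₁ Z₂ N : ModuleCat.{v} R}
    (h₁ : IsSyzygy Z₁ L) (h₂ : IsSyzygy Z₂ Z₁)
    (hfac : ∀ g : L →ₗ[R] N, ∃ (k : ℕ) (a : L →ₗ[R] (Fin k → R)) (b : (Fin k → R) →ₗ[R] N),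
      g = b ∘ₗ a) : Subsingleton (Ext N (nakayamaObj K Z₂) 1) := by
  obtain ⟨P₀, f₀, g₀, w₀, _, _, hS₀⟩ := h₁
  obtain ⟨P₁, f₁, g₁, w₁, _, _, hS₁⟩ := h₂
  obtain ⟨w₀', hS₀'⟩ := shortExact_nakayama K hR f₀ g₀ w₀ hS₀
  obtain ⟨w₁', hS₁'⟩ := shortExact_nakayama K hR f₁ g₁ w₁ hS₁
  have : Projective (nakayamaObj K P₁) :=
    (IsProjective.iff_projective _).1 (Nakayama.projective K hR)
  have := hR.injective_of_projective (nakayamaObj K P₁)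
  have hg₀ : Function.Surjective g₀.hom := (ModuleCat.epi_iff_surjective _).1 hS₀.epi_g
  have hg₁ : Function.Surjective g₁.hom := (ModuleCat.epi_iff_surjective _).1 hS₁.epi_g
  have hex₀ : Function.Exact f₀.hom g₀.hom :=
    (ShortComplex.ShortExact.moduleCat_exact_iff_function_exact _).1 hS₀.exact
  have hex : Function.Exact (f₀.hom ∘ₗ g₁.hom) g₀.hom := fun x => by
    rw [hex₀ x]
    constructor
    · rintro ⟨y, rfl⟩
      obtain ⟨z, rfl⟩ := hg₁ y
      exact ⟨z, rfl⟩
    · rintro ⟨z, rfl⟩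
      exact ⟨_, rfl⟩
  refine subsingleton_of_forall_eq 0 fun x => ?_
  obtain ⟨y, rfl⟩ := Ext.covariant_sequence_exact₁ N hS₁' x
    (Ext.eq_zero_of_injective _) (zero_add 1)
  obtain ⟨y, rfl⟩ := Ext.addEquiv₀.symm.surjective y
  obtain ⟨z, hz⟩ := Nakayama.exists_lift_of_factors K _ _ hex hg₀ hfac
    (Nakayama.map K f₀.hom ∘ₗ y.hom) (by
      rw [← LinearMap.comp_assoc, ← Nakayama.map_comp, hex₀.linearMap_comp_eq_zero]
      exact LinearMap.ext fun q => Nakayama.ext' fun f => by simp)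
  have hzy : ModuleCat.ofHom z ≫ nakayamaMap K P₁ Z₁ g₁ = y := by
    have : Mono (nakayamaMap K Z₁ P₀ f₀) := hS₀'.mono_f
    rw [← cancel_mono (nakayamaMap K Z₁ P₀ f₀)]
    exact ModuleCat.hom_ext hz
  have : (Ext.addEquiv₀.symm y) = (Ext.mk₀ (ModuleCat.ofHom z)).comp
      (Ext.mk₀ (nakayamaMap K P₁ Z₁ g₁)) (zero_add 0) := by
    rw [Ext.mk₀_comp_mk₀, hzy]; rfl
  rw [this, Ext.comp_assoc (Ext.mk₀ _) (Ext.mk₀ (nakayamaMap K P₁ Z₁ g₁)) hS₁'.extClass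
        (zero_add 0) (zero_add 1) (by omega)]
  have h0 : (Ext.mk₀ (nakayamaMap K P₁ Z₁ g₁)).comp hS₁'.extClass (zero_add 1) = 0 :=
    hS₁'.comp_extClass
  rw [h0, Ext.comp_zero]

end NakayamaFunctor

/-! ### Summands of powers of a module -/

section AddClosure

open Abelian
open scoped ModuleCat

variable {R : Type v} [Ring R] (K : Type v) [Field K] [Algebra K R] [Module.Finite K R]

/-- A summand of a finite power of `X` in the form that `finrank_ext_le_sum` needs. -/
theorem sum_comp_eq_id_of_retract {X Y : ModuleCat.{v} R} {k : ℕ} (s : Y →ₗ[R] (Fin k → X))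
    (r : (Fin k → X) →ₗ[R] Y) (hrs : r ∘ₗ s = LinearMap.id) :
    ∑ i, (ModuleCat.ofHom (LinearMap.proj i ∘ₗ s) : Y ⟶ X) ≫
      ModuleCat.ofHom (r ∘ₗ LinearMap.single R (fun _ => X) i) = 𝟙 Y := by
  ext y
  rw [ModuleCat.hom_sum, LinearMap.sum_apply]
  change ∑ i, r (LinearMap.single R (fun _ => X) i (s y i)) = y
  rw [← map_sum]
  simp only [LinearMap.coe_single, Finset.univ_sum_single]
  exact LinearMap.congr_fun hrs y

theorem MemAdd.exists_finrank_ext_le {X Y : ModuleCat.{v} R} [Module.Finite R X] (h : MemAdd X Y) :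
    ∃ k : ℕ, ∀ (S : ModuleCat.{v} R) [Module.Finite R S] (i : ℕ),
      Module.finrank K (Ext Y S i) ≤ k * Module.finrank K (Ext X S i) := by
  obtain ⟨k, s, r, hrs⟩ := h
  exact ⟨k, fun S _ i => (finrank_ext_le_sum K _ _ (sum_comp_eq_id_of_retract s r hrs) S i).trans
    (by simp)⟩

theorem memAdd_pi (X : ModuleCat.{v} R) (k : ℕ) : MemAdd X (ModuleCat.of R (Fin k → X)) :=
  ⟨k, LinearMap.id, LinearMap.id, rfl⟩

/-- Every indecomposable nonprojective summand of `Y ∈ add X` is a summand of `X`, and the number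
of such summands is at most the dimension of the stable endomorphism algebra of `Y`. -/
theorem MemAdd.finrank_ext_le_stableDim_mul {X : ModuleCat.{v} R} [Module.Finite R X]
    (S : ModuleCat.{v} R) [Module.Finite R S] (i : ℕ) {Y : ModuleCat.{v} R} [Module.Finite R Y]
    (h : MemAdd X Y) :
    Module.finrank K (Ext Y S (i + 1)) ≤
      stableDim K Y Y * Module.finrank K (Ext X S (i + 1)) := by
  have : IsArtinianRing R := IsArtinianRing.of_finite K R
  induction hd : Module.finrank K Y using Nat.strong_induction_on generalizing Y with
  | _ d ih =>
  have := Y.finite_of_finite K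
  rcases subsingleton_or_nontrivial Y with hY | hY
  -- the zero module is the empty direct sum
  · have h0 : ∑ i : Empty, (i.elim : Y ⟶ Y) ≫ (i.elim : Y ⟶ Y) = 𝟙 Y := by
      ext y; exact Subsingleton.elim _ _
    have := finrank_ext_le_sum K (X := fun _ : Empty => Y) _ _ h0 S (i + 1)
    simp only [Finset.univ_eq_empty, Finset.sum_empty] at this
    omega
  by_cases hind : ∀ p q : Submodule R Y, IsCompl p q → p = ⊥ ∨ q = ⊥
  · obtain ⟨k, s, r, hrs⟩ := h
    obtain ⟨s', r', hrs'⟩ := exists_retract_of_indecomposable hind s r hrs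
    rcases Nat.eq_zero_or_pos (stableDim K Y Y) with h0 | h0
    · have := projective_of_stableDim_eq_zero K h0
      have : Subsingleton (Ext Y S (i + 1)) := Ext.subsingleton_of_projective _ _ _
      rw [Module.finrank_zero_of_subsingleton]
      exact Nat.zero_le _
    · have h1 : ∑ _i : Unit, (ModuleCat.ofHom s' : Y ⟶ X) ≫ ModuleCat.ofHom r' = 𝟙 Y := by
        rw [Finset.univ_unique, Finset.sum_singleton]
        exact ModuleCat.hom_ext hrs'
      have h2 := finrank_ext_le_sum K (X := fun _ : Unit => X) _ _ h1 S (i + 1)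
      rw [Finset.univ_unique, Finset.sum_singleton] at h2
      exact h2.trans (Nat.le_mul_of_pos_left _ h0)
  · push Not at hind
    obtain ⟨p, q, hpq, hp, hq⟩ := hind
    obtain ⟨k, s, r, hrs⟩ := h
    have hfin : ∀ p q : Submodule R Y, IsCompl p q → q ≠ ⊥ →
        Module.finrank K (ModuleCat.of R p) < d ∧ MemAdd X (ModuleCat.of R p) := by
      intro p q hpq hq
      constructor
      · rw [← hd]
        have hlt : p.restrictScalars K < ⊤ := by
          rw [lt_top_iff_ne_top]
          intro ht
          have : p = ⊤ := (Submodule.restrictScalars_eq_top_iff K R Y).1 ht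
          exact hq (by simpa [this] using hpq.inf_eq_bot)
        exact (Submodule.finrank_lt hlt.ne)
      · refine ⟨k, s ∘ₗ p.subtype, p.projectionOnto q hpq ∘ₗ r, ?_⟩
        ext x
        have : r (s x) = x := LinearMap.congr_fun hrs (x : Y)
        simp [this]
    obtain ⟨hp1, hp2⟩ := hfin p q hpq hq
    obtain ⟨hq1, hq2⟩ := hfin q p hpq.symm hp
    have ihp := ih _ hp1 hp2 rfl
    have ihq := ih _ hq1 hq2 rfl
    let ap : ModuleCat.of R p ⟶ Y := ModuleCat.ofHom p.subtype
    let aq : ModuleCat.of R q ⟶ Y := ModuleCat.ofHom q.subtype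
    let bp : Y ⟶ ModuleCat.of R p := ModuleCat.ofHom (p.projectionOnto q hpq)
    let bq : Y ⟶ ModuleCat.of R q := ModuleCat.ofHom (q.projectionOnto p hpq.symm)
    have hst := stableDim_add_le K ap bp aq bq (by ext x; simp [ap, bp]) (by ext x; simp [aq, bq])
      (by ext x; simp [ap, bq]) (by ext x; simp [aq, bp])
    let A : Bool → ModuleCat.{v} R := fun c => bif c then ModuleCat.of R p else ModuleCat.of R q
    have : ∀ c, Module.Finite R (A c) := by
      rintro (_ | _)
      · exact inferInstanceAs (Module.Finite R q)
      · exact inferInstanceAs (Module.Finite R p)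
    have hsum : ∑ c : Bool, (Bool.rec bq bp c : Y ⟶ A c) ≫ (Bool.rec aq ap c : A c ⟶ Y) = 𝟙 Y := by
      rw [Fintype.sum_bool]
      ext x
      exact Submodule.projection_add_projection_eq_self hpq x
    have h3 := finrank_ext_le_sum K _ _ hsum S (i + 1)
    rw [Fintype.sum_bool] at h3
    refine h3.trans ((Nat.add_le_add ihp ihq).trans ?_)
    rw [← Nat.add_mul]
    exact Nat.mul_le_mul_right _ hst

end AddClosure

/-! ### Sequences of syzygies -/

section SyzygySequences

open Abelian
open scoped ModuleCat

variable {R : Type v} [Ring R] (K : Type v) [Field K] [Algebra K R]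

theorem exists_syzygy_sequence [IsNoetherianRing R] (M : ModuleCat.{v} R) [Module.Finite R M] :
    ∃ Z : ℕ → ModuleCat.{v} R, Z 0 = M ∧ (∀ m, Module.Finite R (Z m)) ∧
      ∀ m, IsSyzygy (Z (m + 1)) (Z m) := by
  choose! Ω hΩ using fun (M : ModuleCat.{v} R) (_ : Module.Finite R M) => exists_isSyzygy M
  refine ⟨fun m => Ω^[m] M, rfl, ?_⟩
  have hfin : ∀ m, Module.Finite R (Ω^[m] M) := fun m => by
    induction m with
    | zero => exact ‹Module.Finite R M›
    | succ m ih => rw [Function.iterate_succ_apply']; exact (hΩ _ ih).1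
  refine ⟨hfin, fun m => ?_⟩
  change IsSyzygy (Ω^[m + 1] M) (Ω^[m] M)
  rw [Function.iterate_succ_apply']
  exact (hΩ _ (hfin m)).2

theorem finrank_ext_syzygy_sequence {Z : ℕ → ModuleCat.{v} R}
    (hZ : ∀ m, IsSyzygy (Z (m + 1)) (Z m)) (N : ModuleCat.{v} R) (i m : ℕ) :
    Module.finrank K (Ext (Z 0) N (i + m + 1)) = Module.finrank K (Ext (Z m) N (i + 1)) := by
  induction m generalizing i with
  | zero => rfl
  | succ m ih =>
    rw [show i + (m + 1) + 1 = (i + 1) + m + 1 by omega, ih, ← (hZ m).finrank_ext K N i]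

theorem finrank_ext_syzygy_sequence' (hR : Module.Baer R R) {Z : ℕ → ModuleCat.{v} R}
    (hZ : ∀ m, IsSyzygy (Z (m + 1)) (Z m))
    (N : ModuleCat.{v} R) (m t : ℕ) :
    Module.finrank K (Ext N (Z (m + t)) (t + 1)) = Module.finrank K (Ext N (Z m) 1) := by
  induction t with
  | zero => rfl
  | succ t ih =>
    rw [← ih]
    exact (hZ (m + t)).finrank_ext' K hR N t

end SyzygySequences

/-! ### Maximal orthogonal modules -/

section MaximalOrthogonal

open Abelian
open scoped ModuleCat

variable {R : Type v} [Ring R] (K : Type v) [Field K] [Algebra K R] [Module.Finite K R]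

/-- If `Ext¹(M, N) = 0` then every map from a syzygy of `M` to `N` factors through a finitely
generated free module. -/
theorem IsSyzygy.exists_factor {Z M N : ModuleCat.{v} R} (h : IsSyzygy Z M)
    [Subsingleton (Ext M N 1)] (g : Z →ₗ[R] N) :
    ∃ (k : ℕ) (a : Z →ₗ[R] (Fin k → R)) (b : (Fin k → R) →ₗ[R] N), g = b ∘ₗ a := by
  obtain ⟨P, f, q, w, _, _, hS⟩ := h
  obtain ⟨k, p, hp⟩ := Module.Finite.exists_fin' R P
  obtain ⟨s, hs⟩ := Module.projective_lifting_property p LinearMap.id hp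
  obtain ⟨y, hy⟩ := Ext.contravariant_sequence_exact₁ hS N (Ext.mk₀ (ModuleCat.ofHom g))
    (add_comm 1 0) (Subsingleton.elim (α := Ext M N 1) _ _)
  obtain ⟨y, rfl⟩ := Ext.addEquiv₀.symm.surjective y
  have hfy : f ≫ y = ModuleCat.ofHom g :=
    Ext.addEquiv₀.symm.injective ((Ext.mk₀_comp_mk₀ _ _).symm.trans hy)
  refine ⟨k, s ∘ₗ f.hom, y.hom ∘ₗ p, ?_⟩
  have : g = y.hom ∘ₗ f.hom := (congrArg ModuleCat.Hom.hom hfy).symm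
  rw [this]
  ext x
  exact congrArg y.hom (LinearMap.congr_fun hs (f.hom x)).symm

variable {n : ℕ} {X : ModuleCat.{v} R}

/-- If `X` is maximal `n`-orthogonal, then `add X` is stable under `ν Ω^{n+2}`: for `Y ∈ add X` and
`1 ≤ j ≤ n`, dimension shifting and the Auslander–Reiten formula turn `Ext^j(X, ν Ω^{n+2} Y)` into
the dual of the stable Hom from `Ω^{n+1-j} Y` to `X`, which is `Ext^{n+1-j}(Y, X) = 0`. -/
theorem IsMaximalOrthogonal.memAdd_nakayamaObj (hR : Module.Baer R R)
    (hX : IsMaximalOrthogonal n X) {Z : ℕ → ModuleCat.{v} R}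
    (hfin : ∀ m, Module.Finite R (Z m)) (hZ : ∀ m, IsSyzygy (Z (m + 1)) (Z m))
    (h0 : MemAdd X (Z 0)) : MemAdd X (nakayamaObj K (Z (n + 2))) := by
  have := hX.1
  refine ((hX.2 (nakayamaObj K (Z (n + 2))) inferInstance).out 1 2).1 fun j hj1 hjn => ?_
  obtain ⟨t, rfl⟩ : ∃ t, j = t + 1 := ⟨j - 1, by omega⟩
  obtain ⟨m, rfl⟩ : ∃ m, n = m + 1 + t := ⟨n - 1 - t, by omega⟩
  rw [← Module.finrank_zero_iff (R := K), show m + 1 + t + 2 = (m + 3) + t by omega,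
    finrank_ext_syzygy_sequence' K hR (Z := fun m => nakayamaObj K (Z m))
      (fun m => (hZ m).nakayamaObj K hR)]
  have hv : Subsingleton (Ext (Z m) X 1) := by
    rw [← Module.finrank_zero_iff (R := K), ← zero_add 1, ← finrank_ext_syzygy_sequence K hZ X 0 m,
      Module.finrank_zero_iff]
    have h : ∀ i, 1 ≤ i → i ≤ m + 1 + t → Subsingleton (Ext (Z 0) X i) :=
      ((hX.2 (Z 0) inferInstance).out 2 0).1 h0
    exact h _ (by omega) (by omega)
  have := subsingleton_ext_nakayamaObj K hR (hZ (m + 1)) (hZ (m + 2)) (N := X)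
    fun g => (hZ m).exists_factor g
  exact Module.finrank_zero_of_subsingleton

theorem finrank_le_of_isSimpleModule (S : ModuleCat.{v} R) [IsSimpleModule R S] :
    Module.finrank K S ≤ Module.finrank K R := by
  have := IsSimpleModule.nontrivial R S
  obtain ⟨x, hx⟩ := exists_ne (0 : S)
  exact LinearMap.finrank_le_finrank_of_surjective
    (f := (LinearMap.toSpanSingleton R S x).restrictScalars K)
    (IsSimpleModule.toSpanSingleton_surjective R hx)

/-- A uniform bound for `dim Ext^i(Y, S)`, `S` simple, over all `i` and all `Y ∈ add X` whose stable
endomorphism algebra is at most as large as that of `X`. The induction step uses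
`Ext^{i+n+2}(Y, S) = Ext^i(Ω^{n+2} Y, S) = Ext^i(ν Ω^{n+2} Y, ν S)`. -/
theorem IsMaximalOrthogonal.exists_bound_of_stableDim_le (hR : Module.Baer R R)
    (hX : IsMaximalOrthogonal n X) :
    ∃ C : ℕ, ∀ (i : ℕ) (Y : ModuleCat.{v} R), Module.Finite R Y → MemAdd X Y →
      stableDim K Y Y ≤ stableDim K X X →
      ∀ S : ModuleCat.{v} R, IsSimpleModule R S → Module.finrank K (Ext Y S (i + 1)) ≤ C := by
  have : IsArtinianRing R := IsArtinianRing.of_finite K R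
  have := hX.1
  choose c hc using fun i => exists_finrank_ext_le K (i + 1) X
  refine ⟨stableDim K X X * ((∑ i ∈ Finset.range (n + 2), c i) * Module.finrank K R),
    fun i => ?_⟩
  induction i using Nat.strong_induction_on with
  | _ i ih =>
  intro Y _ hY hYX S _
  rcases lt_or_ge i (n + 2) with hi | hi
  · refine (hY.finrank_ext_le_stableDim_mul K S i).trans (Nat.mul_le_mul hYX ?_)
    refine (hc i S).2.trans (Nat.mul_le_mul ?_ (finrank_le_of_isSimpleModule K S))
    exact Finset.single_le_sum (f := c) (fun _ _ => Nat.zero_le _) (Finset.mem_range.2 hi)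
  · obtain ⟨i, rfl⟩ : ∃ j, i = j + (n + 2) := ⟨i - (n + 2), by omega⟩
    obtain ⟨Z, rfl, hfin, hZ⟩ := exists_syzygy_sequence Y
    have hst : ∀ m, stableDim K (Z m) (Z m) = stableDim K (Z 0) (Z 0) := fun m => by
      induction m with
      | zero => rfl
      | succ m ihm =>
        rw [(hZ m).stableDim_eq K hR, ihm]
    rw [finrank_ext_syzygy_sequence K hZ, ← finrank_ext_nakayamaObj K hR]
    refine ih i (by omega) _ inferInstance (hX.memAdd_nakayamaObj K hR hfin hZ hY) ?_ _
      (Nakayama.isSimpleModule K hR S)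
    rw [stableDim_nakayamaObj K hR, hst]
    exact hYX

theorem IsMaximalOrthogonal.memAdd_self (hX : IsMaximalOrthogonal n X) :
    MemAdd X (ModuleCat.of R R) :=
  ((hX.2 (ModuleCat.of R R) inferInstance).out 0 2).1 fun i hi _ => by
    obtain ⟨j, rfl⟩ : ∃ j, i = j + 1 := ⟨i - 1, by omega⟩
    exact Ext.subsingleton_of_projective _ _ _

/-- A right `add X`-approximation of `M`: a map `X ^ d → M` through which all maps `X → M` factor.
It is surjective because `R ∈ add X`. -/
theorem exists_approximation (K : Type v) [Field K] [Algebra K R] [Module.Finite K R]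
    [Module.Finite R X] (hRX : MemAdd X (ModuleCat.of R R))
    (M : ModuleCat.{v} R) [Module.Finite R M] :
    ∃ (d : ℕ) (p : (Fin d → X) →ₗ[R] M), Function.Surjective p ∧
      ∀ g : X →ₗ[R] M, ∃ e : X →ₗ[R] (Fin d → X), p ∘ₗ e = g := by
  have := M.finite_of_finite K
  let b := Module.finBasis K (X →ₗ[R] M)
  let p : (Fin _ → X) →ₗ[R] M := ∑ i, b i ∘ₗ LinearMap.proj i
  have hp : ∀ g : X →ₗ[R] M, ∃ e : X →ₗ[R] (Fin _ → X), p ∘ₗ e = g := by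
    intro g
    refine ⟨LinearMap.pi fun i =>
      { toFun x := algebraMap K R (b.repr g i) • x
        map_add' x y := smul_add _ _ _
        map_smul' r x := by
          rw [RingHom.id_apply, ← mul_smul, ← mul_smul, Algebra.commutes] }, ?_⟩
    ext x
    have h := LinearMap.congr_fun (b.sum_repr g) x
    rw [LinearMap.sum_apply] at h
    simpa [p] using h
  refine ⟨_, p, fun m => ?_, hp⟩
  obtain ⟨k, s, r, hrs⟩ := hRX
  choose e he using fun j : Fin k => hp (LinearMap.toSpanSingleton R M m ∘ₗ r ∘ₗ
    LinearMap.single R (fun _ => X) j)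
  refine ⟨∑ j, e j (s (1 : R) j), ?_⟩
  have h1 : ∀ j, p (e j (s (1 : R) j)) = r (Pi.single j (s (1 : R) j)) • m := fun j =>
    LinearMap.congr_fun (he j) _
  rw [map_sum, Finset.sum_congr rfl fun j _ => h1 j, ← Finset.sum_smul]
  have h2 : ∑ j, r (Pi.single j (s (1 : R) j)) = (1 : R) := by
    rw [← map_sum, Finset.univ_sum_single]
    exact LinearMap.congr_fun hrs (1 : R)
  exact (congrArg (· • m) h2).trans (one_smul R m)

/-- Every finitely generated module has an `add X`-resolution of length at most `n`, so the bound
for `X` gives one for every module. The induction is on `t`, for modules `M` with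
`Ext^j(X, M) = 0` for `1 ≤ j ≤ n - t`; kernels of approximations decrease `t`. -/
theorem IsMaximalOrthogonal.exists_bound (hR : Module.Baer R R) (hX : IsMaximalOrthogonal n X)
    (M : ModuleCat.{v} R) [Module.Finite R M] :
    ∃ C : ℕ, ∀ (i : ℕ) (S : ModuleCat.{v} R), IsSimpleModule R S →
      Module.finrank K (Ext M S (i + 1)) ≤ C := by
  have : IsArtinianRing R := IsArtinianRing.of_finite K R
  have := hX.1
  have hadd : ∀ Y : ModuleCat.{v} R, Module.Finite R Y → MemAdd X Y → ∃ C : ℕ, ∀ (i : ℕ)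
      (S : ModuleCat.{v} R), IsSimpleModule R S → Module.finrank K (Ext Y S (i + 1)) ≤ C := by
    intro Y _ hY
    obtain ⟨C, hC⟩ := hX.exists_bound_of_stableDim_le K hR
    obtain ⟨k, hk⟩ := hY.exists_finrank_ext_le K
    exact ⟨k * C, fun i S hS => (hk S (i + 1)).trans (Nat.mul_le_mul_left _
      (hC i X inferInstance ⟨1, LinearMap.pi fun _ => LinearMap.id, LinearMap.proj 0, rfl⟩
        le_rfl S hS))⟩
  suffices h : ∀ t ≤ n, ∀ M : ModuleCat.{v} R, Module.Finite R M →
      (∀ j, 1 ≤ j → j ≤ n - t → Subsingleton (Ext X M j)) → ∃ C : ℕ, ∀ (i : ℕ)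
      (S : ModuleCat.{v} R), IsSimpleModule R S → Module.finrank K (Ext M S (i + 1)) ≤ C from
    h n le_rfl M inferInstance fun j h1 h2 => by omega
  intro t
  induction t with
  | zero => exact fun _ M hM h => hadd M hM (((hX.2 M hM).out 1 2).1 h)
  | succ t ih =>
    intro ht M _ hM
    obtain ⟨d, p, hp, hap⟩ := exists_approximation K hX.memAdd_self M
    let Z := ModuleCat.of R (LinearMap.ker p)
    let V := ModuleCat.of R (Fin d → X)
    have hS : p.shortComplexKer.ShortExact := LinearMap.shortExact_shortComplexKer hp
    have hV : ∀ i, 1 ≤ i → i ≤ n → Subsingleton (Ext X V i) :=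
      ((hX.2 V inferInstance).out 2 1).1 (memAdd_pi X d)
    obtain ⟨C₁, hC₁⟩ := ih (by omega) Z inferInstance fun j hj1 hj2 => by
      refine subsingleton_of_forall_eq 0 fun x => ?_
      obtain ⟨j, rfl⟩ : ∃ i, j = i + 1 := ⟨j - 1, by omega⟩
      have hVj : Subsingleton (Ext X V (j + 1)) := hV _ (by omega) (by omega)
      obtain ⟨y, rfl⟩ := Ext.covariant_sequence_exact₁ X hS x
        (Subsingleton.elim (α := Ext X V (j + 1)) _ _) rfl
      rcases Nat.eq_zero_or_pos j with rfl | hj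
      -- maps `X → M` lift to `X ^ d`, so the connecting map to `Ext¹(X, Z)` vanishes
      · obtain ⟨y, rfl⟩ := Ext.addEquiv₀.symm.surjective y
        obtain ⟨e, he⟩ := hap y.hom
        have hy : Ext.addEquiv₀.symm y = (Ext.mk₀ (ModuleCat.ofHom e : X ⟶ V)).comp
            (Ext.mk₀ p.shortComplexKer.g) (zero_add 0) := by
          rw [Ext.mk₀_comp_mk₀]
          exact congrArg Ext.mk₀ (ModuleCat.hom_ext he.symm)
        rw [hy, Ext.comp_assoc (Ext.mk₀ _) (Ext.mk₀ p.shortComplexKer.g) hS.extClass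
          (zero_add 0) (zero_add 1) (by omega), hS.comp_extClass, Ext.comp_zero]
      · have := hM j hj (by omega)
        rw [Subsingleton.elim (α := Ext X M j) y 0, Ext.zero_comp]
    obtain ⟨C₂, hC₂⟩ := hadd V inferInstance (memAdd_pi X d)
    obtain ⟨c, hc⟩ := exists_finrank_ext_le K 1 M
    refine ⟨c * Module.finrank K R + (C₁ + C₂), fun i S hsimp => ?_⟩
    rcases i with _ | i
    · exact ((hc S).2.trans (Nat.mul_le_mul_left _ (finrank_le_of_isSimpleModule K S))).trans
        (Nat.le_add_right _ _)
    · have : Module.Finite K (Ext p.shortComplexKer.X₁ S (i + 1)) := finite_ext K (i + 1) Z S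
      refine (finrank_ext_le_add K hS S (i + 1)).trans ((Nat.add_le_add (hC₁ i S hsimp)
        (hC₂ (i + 1) S hsimp)).trans (Nat.le_add_left _ _))

end MaximalOrthogonal

/-! ### Growth of minimal resolutions -/

section MinimalResolutions

open Abelian
open scoped ModuleCat

theorem finrank_hom_le_add (K : Type*) [Field K] {C : Type*} [Category* C] [Abelian C] [Linear K C]
    {S : ShortComplex C} (hS : S.ShortExact) (Y : C) [Module.Finite K (Y ⟶ S.X₁)]
    [Module.Finite K (Y ⟶ S.X₂)] [Module.Finite K (Y ⟶ S.X₃)] :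
    Module.finrank K (Y ⟶ S.X₂) ≤ Module.finrank K (Y ⟶ S.X₁) + Module.finrank K (Y ⟶ S.X₃) := by
  let f : (Y ⟶ S.X₁) →ₗ[K] (Y ⟶ S.X₂) := Linear.rightComp K Y S.f
  let g : (Y ⟶ S.X₂) →ₗ[K] (Y ⟶ S.X₃) := Linear.rightComp K Y S.g
  have := hS.mono_f
  have hle : LinearMap.ker g ≤ LinearMap.range f := fun x hx => by
    obtain ⟨l, hl⟩ := hS.exact.lift' x hx
    exact ⟨l, hl⟩
  have h1 := g.finrank_range_add_finrank_ker
  have h2 := (Submodule.finrank_mono hle).trans (LinearMap.finrank_range_le _)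
  have h3 := (LinearMap.range g).finrank_le
  omega

variable {R : Type v} [Ring R]

/-- A projective cover of a finitely generated module is finitely generated. -/
theorem IsSuperfluous.finite {P M : Type*} [AddCommGroup P] [Module R P] [AddCommGroup M]
    [Module R M] [Module.Finite R M] {q : P →ₗ[R] M} (hq : Function.Surjective q)
    (h : IsSuperfluous (LinearMap.ker q)) : Module.Finite R P := by
  obtain ⟨k, p, hp⟩ := Module.Finite.exists_fin' R M
  obtain ⟨s, hs⟩ := Module.projective_lifting_property q p hq
  have htop : LinearMap.range s = ⊤ := h _ (by
    rw [eq_top_iff]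
    intro x _
    obtain ⟨y, hy⟩ := hp (q x)
    refine Submodule.mem_sup.2 ⟨x - s y, ?_, s y, ⟨y, rfl⟩, by abel⟩
    have : q (s y) = p y := LinearMap.congr_fun hs y
    simp [this, hy])
  exact Module.Finite.of_surjective s (LinearMap.range_eq_top.1 htop)

/-- A map to a simple module vanishes on a superfluous submodule. -/
theorem IsSuperfluous.le_ker {P S : Type*} [AddCommGroup P] [Module R P] [AddCommGroup S]
    [Module R S] [IsSimpleModule R S] {W : Submodule R P} (h : IsSuperfluous W) (g : P →ₗ[R] S) :
    W ≤ LinearMap.ker g := by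
  rcases eq_or_ne g 0 with rfl | hg
  · simp
  have hm := LinearMap.isCoatom_ker_of_surjective (LinearMap.surjective_of_ne_zero hg)
  by_contra hle
  have : W ⊔ LinearMap.ker g = ⊤ :=
    hm.2 _ (lt_of_le_of_ne le_sup_right fun he => hle (he ▸ le_sup_left))
  exact hm.1 (h _ this)

/-- The syzygies of a minimal resolution: `N i` is a quotient of the term `Pᵢ` by a superfluous
submodule isomorphic to `N (i + 1)`. -/
theorem IsMinimalResolution.exists_syzygies {M : ModuleCat.{v} R} {P : ProjectiveResolution M}
    (hP : IsMinimalResolution P) :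
    ∃ (N : ℕ → ModuleCat.{v} R) (f : ∀ i, N (i + 1) ⟶ P.complex.X i)
      (q : ∀ i, P.complex.X i ⟶ N i) (w : ∀ i, f i ≫ q i = 0), N 0 = M ∧
      (∀ i, (ShortComplex.mk (f i) (q i) (w i)).ShortExact) ∧
      ∀ i, IsSuperfluous (LinearMap.ker (q i).hom) := by
  have hex0 : (ShortComplex.mk _ _ P.complex_d_comp_π_f_zero).Exact :=
    ShortComplex.exact_of_g_is_cokernel _ P.isColimitCokernelCofork
  have hk0 := (ShortComplex.ShortExact.moduleCat_exact_iff_function_exact _).1 hex0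
  have hk := fun i => (ShortComplex.ShortExact.moduleCat_exact_iff_function_exact _).1
    (P.exact_succ i)
  let N : ℕ → ModuleCat.{v} R := fun i => match i with
    | 0 => M
    | i + 1 => ModuleCat.of R (LinearMap.range (P.complex.d (i + 1) i).hom)
  let f : ∀ i, N (i + 1) ⟶ P.complex.X i := fun i =>
    ModuleCat.ofHom (LinearMap.range (P.complex.d (i + 1) i).hom).subtype
  let q : ∀ i, P.complex.X i ⟶ N i := fun i => match i with
    | 0 => P.π.f 0
    | i + 1 => ModuleCat.ofHom (P.complex.d (i + 1) i).hom.rangeRestrict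
  have hsurj : ∀ i, Function.Surjective (q i).hom := by
    rintro (_ | i)
    · exact (ModuleCat.epi_iff_surjective (P.π.f 0)).1 inferInstance
    · exact LinearMap.surjective_rangeRestrict _
  have hker : ∀ i, LinearMap.ker (q i).hom = LinearMap.range (P.complex.d (i + 1) i).hom := by
    rintro (_ | i)
    · exact LinearMap.exact_iff.1 hk0
    · exact (LinearMap.ker_rangeRestrict _).trans (LinearMap.exact_iff.1 (hk i))
  have hexact : ∀ i, Function.Exact (f i).hom (q i).hom := fun i =>
    LinearMap.exact_iff.2 ((hker i).trans (Submodule.range_subtype _).symm)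
  refine ⟨N, f, q, fun i => ModuleCat.hom_ext (hexact i).linearMap_comp_eq_zero, rfl, fun i =>
    ModuleCat.shortComplex_shortExact _ (hexact i) (Submodule.injective_subtype _) (hsurj i),
    fun i => ?_⟩
  rw [hker]
  exact hP i

variable (K : Type v) [Field K] [Algebra K R]

theorem finrank_hom_eq_of_isSuperfluous {P N : ModuleCat.{v} R} (q : P ⟶ N)
    (hq : Function.Surjective q.hom) (h : IsSuperfluous (LinearMap.ker q.hom))
    (S : ModuleCat.{v} R) [IsSimpleModule R S] :
    Module.finrank K (P ⟶ S) = Module.finrank K (N ⟶ S) := by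
  have : Epi q := (ModuleCat.epi_iff_surjective _).2 hq
  refine (LinearEquiv.ofBijective (Linear.leftComp K S q)
    ⟨fun a b hab => (cancel_epi q).1 hab, fun g => ?_⟩).finrank_eq.symm
  obtain ⟨g', hg'⟩ := LinearMap.exists_comp_eq_of_ker_le hq (h.le_ker g.hom)
  exact ⟨ModuleCat.ofHom g', ModuleCat.hom_ext hg'⟩

variable [Module.Finite K R]

/-- A bound for the maps to simple modules gives one for all modules, by induction on length. -/
theorem finrank_hom_le_mul {P : ModuleCat.{v} R} [Module.Finite R P] {C : ℕ}
    (hC : ∀ S : ModuleCat.{v} R, IsSimpleModule R S → Module.finrank K (P ⟶ S) ≤ C)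
    (N : ModuleCat.{v} R) [Module.Finite R N] :
    Module.finrank K (P ⟶ N) ≤ C * Module.finrank K N := by
  have : IsArtinianRing R := IsArtinianRing.of_finite K R
  induction hd : Module.finrank K N using Nat.strong_induction_on generalizing N with
  | _ d ih =>
  have := N.finite_of_finite K
  obtain h0 | ⟨T, hT, -⟩ := IsAtomic.eq_bot_or_exists_atom_le (⊤ : Submodule R N)
  · have : Subsingleton N := (Submodule.subsingleton_iff R).1 (subsingleton_of_bot_eq_top h0.symm)
    have : Subsingleton (P ⟶ N) := ⟨fun a b => by ext x; exact Subsingleton.elim _ _⟩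
    rw [Module.finrank_zero_of_subsingleton]
    exact Nat.zero_le _
  · have hTs : IsSimpleModule R T := isSimpleModule_iff_isAtom.2 hT
    have hS : (ShortComplex.mk (ModuleCat.ofHom T.subtype) (ModuleCat.ofHom T.mkQ)
        (by ext x; simp)).ShortExact :=
      ModuleCat.shortComplex_shortExact _ (LinearMap.exact_subtype_mkQ T) T.injective_subtype
        T.mkQ_surjective
    have h1 := finrank_hom_le_add K hS P
    have h2 := hC (ModuleCat.of R T) hTs
    have hdim : Module.finrank K (ModuleCat.of R (N ⧸ T)) +
        Module.finrank K (ModuleCat.of R T) = d := by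
      let g : N →ₗ[K] ModuleCat.of R (N ⧸ T) :=
        (ModuleCat.ofHom T.mkQ : N ⟶ ModuleCat.of R (N ⧸ T)).hom.restrictScalars K
      let j : ModuleCat.of R T →ₗ[K] N :=
        (ModuleCat.ofHom T.subtype : ModuleCat.of R T ⟶ N).hom.restrictScalars K
      have hg : Function.Surjective g := T.mkQ_surjective
      have hj : Function.Injective j := T.injective_subtype
      have hgj : LinearMap.ker g = LinearMap.range j :=
        LinearMap.exact_iff.1 (LinearMap.exact_subtype_mkQ T : Function.Exact j g)
      have := g.finrank_range_add_finrank_ker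
      rwa [LinearMap.range_eq_top.2 hg, finrank_top, hgj, LinearMap.finrank_range_of_inj hj, hd]
        at this
    have hT0 : 0 < Module.finrank K (ModuleCat.of R T) := by
      have := IsSimpleModule.nontrivial R T
      have := (ModuleCat.of R T).finite_of_finite K
      exact Module.finrank_pos
    have h3 := ih (Module.finrank K (ModuleCat.of R (N ⧸ T))) (by omega)
      (ModuleCat.of R (N ⧸ T)) rfl
    refine h1.trans ((Nat.add_le_add h2 h3).trans ?_)
    rw [← hdim, Nat.mul_add, Nat.add_comm]
    exact Nat.add_le_add_left (Nat.le_mul_of_pos_right _ hT0) _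

/-- The dimension of `P` is bounded by those of the spaces of maps from `P` to simple modules,
since `P` embeds into `R ^ d` with `d = dim Hom(P, R)`. -/
theorem finrank_le_mul_sq (hR : Module.Baer R R) {P : ModuleCat.{v} R} [Module.Finite R P] {C : ℕ}
    (hC : ∀ S : ModuleCat.{v} R, IsSimpleModule R S → Module.finrank K (P ⟶ S) ≤ C) :
    Module.finrank K P ≤ C * Module.finrank K R * Module.finrank K R := by
  -- an arbitrary copy `N` of `R` keeps apart the `K`-module structures of the algebra `R` and of
  -- the object `R` of `ModuleCat R`
  have h1 : ∀ N : ModuleCat.{v} R, (N ≃ₗ[R] R) →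
      Module.finrank K (P ⟶ N) = Module.finrank K (P →ₗ[R] R) ∧
      Module.finrank K N = Module.finrank K R := fun N e =>
    ⟨LinearEquiv.finrank_eq
      { toFun g := e.toLinearMap ∘ₗ g.hom
        invFun g := ModuleCat.ofHom (e.symm.toLinearMap ∘ₗ g)
        left_inv g := by ext; simp
        right_inv g := by ext; simp
        map_add' _ _ := by ext; simp
        map_smul' c g := by
          ext x
          change e (algebraMap K R c • g.hom x) = c • e (g.hom x)
          rw [map_smul, algebraMap_smul] },
      (e.restrictScalars K).finrank_eq⟩
  obtain ⟨h1, h2⟩ := h1 (ModuleCat.of R R) (LinearEquiv.refl R R)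
  have h3 := finrank_hom_le_mul K hC (ModuleCat.of R R)
  have h4 := LinearMap.finrank_le_finrank_of_injective
    (f := (LinearMap.pi (Module.finBasis K (P →ₗ[R] R)) : P →ₗ[R] (_ → R)).restrictScalars K)
    (Nakayama.pi_finBasis_injective K hR)
  rw [Module.finrank_pi_fintype, Finset.sum_const, Finset.card_univ, Fintype.card_fin,
    smul_eq_mul] at h4
  rw [h1, h2] at h3
  exact h4.trans (Nat.mul_le_mul_right _ h3)

/-- The terms of the minimal projective resolution of a finitely generated module are generated by
a bounded number of elements, if there is a maximal `n`-orthogonal module: for simple `S` the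
dimension of `Hom(Pᵢ, S)` is that of `Ext^i(M, S)`, which is bounded. -/
theorem IsMaximalOrthogonal.exists_generators_bound (K : Type v) [Field K]
    [Algebra K R] [Module.Finite K R] (hR : Module.Baer R R) {n : ℕ}
    {X : ModuleCat.{v} R} (hX : IsMaximalOrthogonal n X) {M : ModuleCat.{v} R}
    [hM : Module.Finite R M] {P : ProjectiveResolution M} (hP : IsMinimalResolution P) :
    ∃ C : ℕ, ∀ i, ∃ m ≤ C, ∃ p : (Fin m → R) →ₗ[R] P.complex.X i, Function.Surjective p := by
  have : IsArtinianRing R := IsArtinianRing.of_finite K R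
  obtain ⟨C₁, hC₁⟩ := hX.exists_bound K hR M
  obtain ⟨c, hc⟩ := exists_finrank_ext_le K 0 M
  obtain ⟨N, f, q, w, hN0, hS, hsup⟩ := hP.exists_syzygies
  have hsurj : ∀ i, Function.Surjective (q i).hom := fun i =>
    (ModuleCat.epi_iff_surjective _).1 (hS i).epi_g
  have hPfin : ∀ i, Module.Finite R (N i) → Module.Finite R (P.complex.X i) := fun i _ =>
    (hsup i).finite (hsurj i)
  have hNfin : ∀ i, Module.Finite R (N i) := fun i => by
    induction i with
    | zero => rw [hN0]; exact hM
    | succ i ih =>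
      have := hPfin i ih
      exact Module.Finite.of_injective (f i).hom ((ModuleCat.mono_iff_injective _).1 (hS i).mono_f)
  have hPfin' := fun i => hPfin i (hNfin i)
  have hsyz : ∀ i, IsSyzygy (N (i + 1)) (N i) := fun i =>
    ⟨_, f i, q i, w i, hPfin' i, P.projective i, hS i⟩
  have hbound : ∀ i, ∀ S : ModuleCat.{v} R, IsSimpleModule R S →
      Module.finrank K (P.complex.X i ⟶ S) ≤ c * Module.finrank K R + C₁ := by
    rintro (_ | i) S hSs
    · rw [finrank_hom_eq_of_isSuperfluous K (q 0) (hsurj 0) (hsup 0), hN0,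
        ← (Ext.linearEquiv₀ (R := K) (X := M) (Y := S)).finrank_eq]
      exact ((hc S).2.trans (Nat.mul_le_mul_left _ (finrank_le_of_isSimpleModule K S))).trans
        (Nat.le_add_right _ _)
    · have h1 : Module.finrank K (Ext (N i) S 1) + Module.finrank K (P.complex.X i ⟶ S) =
          Module.finrank K (N (i + 1) ⟶ S) + Module.finrank K (N i ⟶ S) :=
        finrank_ext_one_add K (hS i) S
      have h2 := finrank_hom_eq_of_isSuperfluous K (q i) (hsurj i) (hsup i) S
      have h3 := finrank_hom_eq_of_isSuperfluous K (q (i + 1)) (hsurj _) (hsup _) S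
      have h4 : Module.finrank K (Ext (N 0) S (i + 1)) = Module.finrank K (Ext (N i) S 1) := by
        rw [show i + 1 = 0 + i + 1 by omega]
        exact finrank_ext_syzygy_sequence K hsyz S 0 i
      have h5 := hC₁ i S hSs
      rw [← hN0] at h5
      omega
  refine ⟨_, fun i => ⟨_, finrank_le_mul_sq K hR (hbound i), ?_⟩⟩
  have := (P.complex.X i).finite_of_finite K
  let b := Module.finBasis K (P.complex.X i)
  refine ⟨Fintype.linearCombination R b, fun x => ⟨fun j => algebraMap K R (b.repr x j), ?_⟩⟩
  rw [Fintype.linearCombination_apply]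
  simp_rw [algebraMap_smul]
  exact b.sum_repr x

end MinimalResolutions

/-! ### Existence of minimal resolutions -/

section ResolutionFromSequences

universe v' u'

variable {C : Type u'} [Category.{v'} C] [Abelian C] {N P : ℕ → C} (f : ∀ i, N (i + 1) ⟶ P i)
  (q : ∀ i, P i ⟶ N i) (w : ∀ i, f i ≫ q i = 0)

/-- The chain complex obtained by splicing the sequences `N (i + 1) ⟶ P i ⟶ N i`. -/
noncomputable def splicedComplex : ChainComplex C ℕ :=
  ChainComplex.of P (fun i => q (i + 1) ≫ f i) fun i => by
    rw [Category.assoc, reassoc_of% (w (i + 1)), Limits.zero_comp, Limits.comp_zero]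

theorem splicedComplex_d (i : ℕ) : (splicedComplex f q w).d (i + 1) i = q (i + 1) ≫ f i :=
  ChainComplex.of_d P (fun i => q (i + 1) ≫ f i) i

theorem splicedComplex_d_comp :
    (splicedComplex f q w).d 1 0 ≫ (show (splicedComplex f q w).X 0 ⟶ N 0 from q 0) = 0 :=
  (congrArg (· ≫ q 0) (splicedComplex_d f q w 0)).trans
    ((Category.assoc (q 1) (f 0) (q 0)).trans
      ((congrArg (q 1 ≫ ·) (w 0)).trans Limits.comp_zero))

/-- Exactness transported along equalities of the two maps. -/
theorem exact_of_eq {X₁ X₂ X₃ : C} {f f' : X₁ ⟶ X₂} {g g' : X₂ ⟶ X₃} {w : f ≫ g = 0}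
    (h : (ShortComplex.mk f g w).Exact) (hf : f' = f) (hg : g' = g) (w' : f' ≫ g' = 0) :
    (ShortComplex.mk f' g' w').Exact := by
  subst hf hg
  exact h

/-- Exactness of a spliced sequence at `P i`, for an arbitrary monomorphism out of `N i`: the
inclusion into the next term, or the identity in degree `0`. -/
theorem exact_splice (hS : ∀ i, (ShortComplex.mk (f i) (q i) (w i)).ShortExact) (i : ℕ) {Y : C}
    (g : N i ⟶ Y) [Mono g] :
    (ShortComplex.mk (q (i + 1) ≫ f i) (q i ≫ g) (by
      rw [Category.assoc, reassoc_of% (w i), Limits.zero_comp, Limits.comp_zero])).Exact := by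
  have := (hS (i + 1)).epi_g
  let α : ShortComplex.mk (q (i + 1) ≫ f i) (q i ≫ g) (by
      rw [Category.assoc, reassoc_of% (w i), Limits.zero_comp, Limits.comp_zero]) ⟶
      ShortComplex.mk (f i) (q i ≫ g) (by rw [reassoc_of% (w i), Limits.zero_comp]) :=
    { τ₁ := q (i + 1)
      τ₂ := 𝟙 _
      τ₃ := 𝟙 _ }
  let β : ShortComplex.mk (f i) (q i) (w i) ⟶
      ShortComplex.mk (f i) (q i ≫ g) (by rw [reassoc_of% (w i), Limits.zero_comp]) :=
    { τ₁ := 𝟙 _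
      τ₂ := 𝟙 _
      τ₃ := g }
  rw [ShortComplex.exact_iff_of_epi_of_isIso_of_mono α,
    ← ShortComplex.exact_iff_of_epi_of_isIso_of_mono β]
  exact (hS i).exact

theorem splicedComplex_exactAt (hS : ∀ i, (ShortComplex.mk (f i) (q i) (w i)).ShortExact)
    (i : ℕ) : (splicedComplex f q w).ExactAt (i + 1) := by
  rw [HomologicalComplex.exactAt_iff' _ (i + 1 + 1) (i + 1) i (by simp) (by simp)]
  have := (hS i).mono_f
  exact exact_of_eq (exact_splice f q w hS (i + 1) (f i))
    (splicedComplex_d f q w (i + 1)) (splicedComplex_d f q w i) _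

/-- The projective resolution of `N 0` obtained by splicing short exact sequences
`0 ⟶ N (i + 1) ⟶ P i ⟶ N i ⟶ 0` with `P i` projective. -/
noncomputable def splicedResolution (hP : ∀ i, Projective (P i))
    (hS : ∀ i, (ShortComplex.mk (f i) (q i) (w i)).ShortExact) : ProjectiveResolution (N 0) where
  complex := splicedComplex f q w
  projective := hP
  π := (ChainComplex.toSingle₀Equiv _ _).symm ⟨q 0, splicedComplex_d_comp f q w⟩
  quasiIso := ⟨fun n => by
    cases n
    · rw [ChainComplex.quasiIsoAt₀_iff, ShortComplex.quasiIso_iff_of_zeros' _ rfl rfl rfl]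
      have hepi := (hS 0).epi_g
      have hex := exact_splice f q w hS 0 (𝟙 (N 0))
      have hπ : ((ChainComplex.toSingle₀Equiv (splicedComplex f q w) (N 0)).symm
        ⟨q 0, splicedComplex_d_comp f q w⟩).f 0 = q 0 :=
          ChainComplex.toSingle₀Equiv_symm_apply_f_zero _ _
      refine ⟨exact_of_eq hex (splicedComplex_d f q w 0)
        (hπ.trans (Category.comp_id _).symm) _, ?_⟩
      change Epi (((ChainComplex.toSingle₀Equiv (splicedComplex f q w) (N 0)).symm
        ⟨q 0, splicedComplex_d_comp f q w⟩).f 0)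
      rw [hπ]
      exact hepi
    · rw [quasiIsoAt_iff_exactAt']
      · apply splicedComplex_exactAt f q w hS
      · apply ChainComplex.exactAt_succ_single_obj⟩

end ResolutionFromSequences

section ProjectiveCovers

variable {R : Type v} [Ring R]

/-- Finitely generated modules over a finite-dimensional algebra have projective covers: take a
projective module of least dimension mapping onto `M`. If it were not a cover, Fitting's lemma would
split off a smaller projective module mapping onto `M`. -/
theorem exists_projectiveCover (K : Type*) [Field K] [Algebra K R] [Module.Finite K R]
    (M : ModuleCat.{v} R) [Module.Finite R M] :
    ∃ (P : ModuleCat.{v} R) (q : P →ₗ[R] M), Module.Finite R P ∧ Module.Projective R P ∧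
      Function.Surjective q ∧ IsSuperfluous (LinearMap.ker q) := by
  have : IsArtinianRing R := IsArtinianRing.of_finite K R
  -- the dimensions of the projective modules mapping onto `M`
  let D : Set ℕ := {d | ∃ (P : ModuleCat.{v} R) (q : P →ₗ[R] M), Module.Finite R P ∧
    Module.Projective R P ∧ Function.Surjective q ∧
    Module.finrank K (RestrictScalars K R P) = d}
  have hD : D.Nonempty := by
    obtain ⟨k, p, hp⟩ := Module.Finite.exists_fin' R M
    exact ⟨_, ModuleCat.of R (Fin k → R), p, inferInstance,
      inferInstanceAs (Module.Projective R (Fin k → R)), hp, rfl⟩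
  obtain ⟨P, q, _, _, hq, hPd⟩ := Nat.sInf_mem hD
  refine ⟨P, q, inferInstance, inferInstance, hq, fun T hT => ?_⟩
  by_contra hTtop
  have hqT : Function.Surjective (q ∘ₗ T.subtype) := fun m => by
    obtain ⟨x, rfl⟩ := hq m
    obtain ⟨y, hy, t, ht, rfl⟩ := Submodule.mem_sup.1 (hT ▸ Submodule.mem_top : x ∈ _)
    refine ⟨⟨t, ht⟩, ?_⟩
    rw [map_add, LinearMap.mem_ker.1 hy, zero_add]
    rfl
  obtain ⟨g, hg⟩ := Module.projective_lifting_property _ q hqT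
  -- `q ∘ h = q`, so the eventual image of `h`, a summand of `P` inside `T`, still maps onto `M`
  let h : Module.End R P := T.subtype ∘ₗ g
  have hqh : ∀ m : ℕ, ∀ x, q ((h ^ m) x) = q x := by
    intro m
    induction m with
    | zero => intro x; rfl
    | succ m ih =>
      intro x
      rw [pow_succ, Module.End.mul_apply, ih]
      exact LinearMap.congr_fun hg x
  obtain ⟨m, hm⟩ := Filter.eventually_atTop.1 h.eventually_isCompl_ker_pow_range_pow
  have hc := (hm (m + 1) (by omega)).symm
  let P' := LinearMap.range (h ^ (m + 1))
  have hP'T : P' ≤ T := by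
    rintro _ ⟨x, rfl⟩
    rw [pow_succ', Module.End.mul_apply]
    exact (g _).2
  have hproj : Module.Projective R P' := Module.Projective.of_split P'.subtype
    (P'.projectionOnto _ hc) (Submodule.projectionOnto_comp_subtype hc)
  have hmem : Module.finrank K (RestrictScalars K R P') ∈ D :=
    ⟨ModuleCat.of R P', q ∘ₗ P'.subtype, inferInstanceAs (Module.Finite R P'), hproj, fun y => by
      obtain ⟨x, rfl⟩ := hq y
      exact ⟨⟨(h ^ (m + 1)) x, x, rfl⟩, hqh (m + 1) x⟩, rfl⟩
  have hle := Nat.sInf_le hmem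
  rw [← hPd] at hle
  let _ : Module K P := Module.restrictScalars K R P
  have : IsScalarTower K R P := IsScalarTower.restrictScalars K R P
  have : Module.Finite K P := Module.Finite.trans R P
  have hlt : Module.finrank K (P'.restrictScalars K) < Module.finrank K P :=
    Submodule.finrank_lt fun ht => hTtop (eq_top_iff.2 fun x _ =>
      hP'T ((Submodule.restrictScalars_eq_top_iff K R P).1 ht ▸ Submodule.mem_top))
  exact absurd hle (not_le.2 hlt)

/-- Finitely generated modules over a finite-dimensional algebra have minimal projective
resolutions. -/
theorem exists_isMinimalResolution (K : Type*) [Field K] [Algebra K R] [Module.Finite K R]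
    (M : ModuleCat.{v} R) [hM : Module.Finite R M] :
    ∃ P : ProjectiveResolution M, IsMinimalResolution P := by
  have : IsArtinianRing R := IsArtinianRing.of_finite K R
  choose! cov q hcov using fun (M : ModuleCat.{v} R) (_ : Module.Finite R M) =>
    exists_projectiveCover K M
  let N : ℕ → ModuleCat.{v} R := fun i =>
    Nat.rec (motive := fun _ => ModuleCat.{v} R) M
      (fun _ L => ModuleCat.of R (LinearMap.ker (q L))) i
  have hN : ∀ i, Module.Finite R (N i) := fun i => by
    induction i with
    | zero => exact hM
    | succ i ih =>
      have := (hcov _ ih).1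
      exact inferInstanceAs (Module.Finite R (LinearMap.ker (q (N i))))
  let f : ∀ i, N (i + 1) ⟶ cov (N i) := fun i => ModuleCat.ofHom (LinearMap.ker (q (N i))).subtype
  let p : ∀ i, cov (N i) ⟶ N i := fun i => ModuleCat.ofHom (q (N i))
  have hS := fun i => LinearMap.shortExact_shortComplexKer (hcov _ (hN i)).2.2.1
  have w : ∀ i, f i ≫ p i = 0 := fun i => (q (N i)).shortComplexKer.zero
  let res : ProjectiveResolution M := splicedResolution f p w
    (fun i => by have := (hcov _ (hN i)).2.1; exact (IsProjective.iff_projective _).1 this) hS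
  refine ⟨res, fun i => ?_⟩
  have hd : res.complex.d (i + 1) i = p (i + 1) ≫ f i := splicedComplex_d f p w i
  have hr : LinearMap.range (res.complex.d (i + 1) i).hom = LinearMap.ker (q (N i)) := by
    rw [hd]
    change LinearMap.range ((LinearMap.ker (q (N i))).subtype ∘ₗ q (N (i + 1))) = _
    rw [LinearMap.range_comp_of_range_eq_top _
      (LinearMap.range_eq_top.2 (hcov _ (hN (i + 1))).2.2.1), Submodule.range_subtype]
  rw [hr]
  exact (hcov _ (hN i)).2.2.2

end ProjectiveCovers

/-! ### Complexity -/

section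

variable {R : Type v} [Ring R]

/-- In terms of left modules, `A` selfinjective means that `Aᵐᵒᵖ` is injective over itself. -/
theorem IsSelfinjective.baer {A : Type v} [Ring A] (hA : IsSelfinjective A) :
    Module.Baer Aᵐᵒᵖ Aᵐᵒᵖ := by
  have : Module.Injective Aᵐᵒᵖ A := hA
  have e : A ≃ₗ[Aᵐᵒᵖ] Aᵐᵒᵖ :=
    { MulOpposite.opAddEquiv with map_smul' := fun _ _ => rfl }
  exact (Module.Baer.of_injective this).of_equiv e

/-- The terms of a minimal resolution have bounded dimension. The universe of `K` is arbitrary. -/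
theorem IsMaximalOrthogonal.exists_termDim_bound {K : Type u} [Field K] [Algebra K R]
    [Module.Finite K R] (hR : Module.Baer R R) {n : ℕ} {X : ModuleCat.{v} R}
    (hX : IsMaximalOrthogonal n X) {M : ModuleCat.{v} R} [Module.Finite R M]
    {P : ProjectiveResolution M} (hP : IsMinimalResolution P) :
    ∃ C, ∀ i, termDim K P i ≤ C := by
  obtain _ | _ := subsingleton_or_nontrivial R
  · refine ⟨0, fun i => le_of_eq ?_⟩
    have : Subsingleton (RestrictScalars K R (P.complex.X i)) :=
      Module.subsingleton R (P.complex.X i)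
    exact Module.finrank_zero_of_subsingleton
  -- `K` embeds into `R`, so it has a copy in the universe of `R`.
  have : Small.{v} K := small_of_injective (algebraMap K R).injective
  let e : Shrink.{v} K ≃+* K := Shrink.ringEquiv K
  let _ : Algebra (Shrink.{v} K) K := e.toRingHom.toAlgebra
  let _ : Algebra (Shrink.{v} K) R := Algebra.compHom R e.toRingHom
  have : IsScalarTower (Shrink.{v} K) K R := IsScalarTower.of_algebraMap_eq fun _ => rfl
  have : Module.Finite (Shrink.{v} K) K :=
    Module.Finite.of_surjective (Algebra.linearMap (Shrink.{v} K) K) e.surjective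
  have : Module.Finite (Shrink.{v} K) R := Module.Finite.trans K R
  obtain ⟨C, hC⟩ := hX.exists_generators_bound (Shrink.{v} K) hR hP
  refine ⟨C * Module.finrank K R, fun i => ?_⟩
  obtain ⟨m, hm, p, hp⟩ := hC i
  let _ : Module K (P.complex.X i) := Module.restrictScalars K R (P.complex.X i)
  have : IsScalarTower K R (P.complex.X i) := IsScalarTower.restrictScalars K R (P.complex.X i)
  calc
    termDim K P i = Module.finrank K (P.complex.X i) := rfl
    _ ≤ Module.finrank K (Fin m → R) :=
      (p.restrictScalars K).finrank_le_finrank_of_surjective hp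
    _ = m * Module.finrank K R := by
      rw [Module.finrank_pi_fintype, Finset.sum_const, Finset.card_univ, Fintype.card_fin,
        smul_eq_mul]
    _ ≤ C * Module.finrank K R := Nat.mul_le_mul_right _ hm

end

theorem theorem1p1 {K : Type u} {A : Type v} [Field K] [Ring A] [Algebra K A]
    [Module.Finite K A] (hA : IsSelfinjective A) (n : ℕ) (hn : 1 ≤ n)
    (hX : ∃ X : ModuleCat.{v} Aᵐᵒᵖ, IsMaximalOrthogonal n X)
    (M : ModuleCat.{v} Aᵐᵒᵖ) (hM : Module.Finite Aᵐᵒᵖ M) :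
    complexity K M ≤ 1 ∧
      ∀ P : ProjectiveResolution M, IsMinimalResolution P →
        ∃ C : ℕ, ∀ i : ℕ, termDim K P i ≤ C := by
  obtain ⟨X, hX⟩ := hX
  have hbound : ∀ P : ProjectiveResolution M, IsMinimalResolution P →
      ∃ C : ℕ, ∀ i : ℕ, termDim K P i ≤ C := fun P hP =>
    hX.exists_termDim_bound hA.baer hP
  refine ⟨?_, hbound⟩
  obtain ⟨P, hP⟩ := exists_isMinimalResolution K M
  obtain ⟨C, hC⟩ := hbound P hP
  refine sInf_le ⟨1, ⟨P, hP, C + 1, by positivity, fun i _ => ?_⟩, rfl⟩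
  have : (termDim K P i : ℝ) ≤ C := by exact_mod_cast hC i
  simpa using this.trans (by linarith)
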